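/- **Setting.** Let $\mathscr P$ be the restricted (proper orthochronous) Poincaré group of Minkowski space $\mathbb R^4$ (signature $+,-,-,-$). Let $(F_{\mu\nu},U)$ be a quantum electromagnetic field on a Hilbert space $\mathcal H$: $U$ is a unitary representation of $\mathscr P$ with a unique vacuum and satisfying the spectrum condition; $F_{\mu\nu}(f)$, $f\in\mathcal S(\mathbb R^4)$ real, are operators mapping a dense $U$-invariant domain $\mathcal D$, which contains the vacuum, into itself; they are linear in $f$ with tempered matrix elements, antisymmetric in $\mu,\nu$, covariant, satisfy the first Maxwell equation and strong causality ($e^{iF_{\mu\nu}(f)}$ and $e^{iF_{\alpha\beta}(g)}$ commute if $\operatorname{supp} f$ and $\operatorname{supp} g$ are causally disjoint), and all contractions of $F$ with real 1- and 2-tensors of test functions are essentially self-adjoint on $\mathcal D$. An exponential of such an operator is that of its closure. The field is not assumed to be free. An affine smearing $n$-simplex is $s=(s_0,\dots,s_n;f)$ with vertices $s_i\in\mathbb R^4$ and a real $f\in\mathcal S(\mathbb R^4)$ with $0\in\operatorname{supp}f$; $\Sigma_n$ is the set of these, $\partial_i$ omits $s_i$, $P=(x,L)$ acts by $P$ on the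 vertices and by $f\mapsto f\circ L^{-1}$, and $\Sigma_n^a$ is the set of those with the same $f$ as $a\in\Sigma_0$. The opposite of $b=(b_0,b_1;f)$ is $\bar b=(b_1,b_0;f)$. A path $b_n\cdots b_1:\partial_1b_1\to\partial_0b_n$ is a nonempty word in $\Sigma_1$ with $\partial_0b_i=\partial_1b_{i+1}$, and its opposite is $\bar b_1\cdots\bar b_n$. Let $e_{(a,a')}$ be the segment from $a'$ to $a$, and $e_a=e_{(a,a)}$. A covariant path-frame system $\mathcal P$ is a choice of paths $p_{(a,a')}:a'\to a$ ($a\in\Sigma_0$, $a'\in\Sigma_0^a$) with $p_{(a,a)}=e_a$ and $Pp_{(a,a')}=p_{(Pa,Pa')}$ for $P\in\mathscr P$; the Euclidean one, $\mathcal E$, is given by the $e_{(a,a')}$. For $c=(c_0,c_1,c_2;f)$ let $\sigma$ be the affine triangle with vertices $c_i$ and $$\mathrm w^{em}(c)=\exp\Big(\tfrac i2F_{\mu\nu}(\sigma[f]^{\mu\nu})\Big),\qquad \sigma[f]^{\mu\nu}(x)=\int_{\Delta_2}f(x-\sigma(t))\,(\partial_1\sigma^\mu\partial_2\sigma^\nu-\partial_2\sigma^\mu\partial_1\sigma^\nu)\,d^2t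 .$$ For a loop $p=b_n\cdots b_1$ over $a$ put $\lambda^{em}(p)=\mathrm w^{em}(h^a(b_n))\cdots\mathrm w^{em}(h^a(b_1))$, where $h^a(b)=(a_0,b_0,b_1;f)$ is the cone over $b$. For $b=(b_0,b_1;f)\in\Sigma_1^a$ and $r_b(s)=b_0+s(b_1-b_0)$ put $$\mathrm u^{em}_{\mathcal P_a}(b)=\lambda^{em}\big(p_{(a,\partial_0b)}\,b\,\bar p_{(a,\partial_1b)}\big),\qquad \mathrm u^{pot}_a(b)=\exp\big(iA^{a_0}\langle r_b,f\rangle\big),$$ where $A^z\langle r,f\rangle=F_{\mu\nu}(r^{z,\mu\nu}_f)$, with $r^{z,\mu\nu}_f(x)=\int_0^1\!\int_0^1(r(s)-z)^\mu\,t\,f\big(x-z-t(r(s)-z)\big)\,dt\;\dot r^\nu(s)\,ds$, is the line integral of the potential form with pole $z$. For families $\mathrm u=\{\mathrm u_a:\Sigma_1^a\to\mathcal U\mathcal H\}$, $\mathrm u$ is a connection system if $\mathrm u_a(\bar b)=\mathrm u_a(b)^*$ and $\mathrm u_a(e_{a'})=1$. It is extended to paths by $\mathrm u_a(b_n\cdots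 b_1)=\mathrm u_a(b_n)\cdots\mathrm u_a(b_1)$. It is causal if $\mathrm u_a(p)$ and $\mathrm u_{a'}(p')$ commute for loops $p$ over $a$ and $p'$ over $a'$ supported in causally disjoint double cones (the support of a word is the union of the supports of the letters of its reduced word, in which degenerate simplices and pairs $b\bar b$ are removed), and covariant if $U(P)\mathrm u_a(b)U(P)^*=\mathrm u_{Pa}(Pb)$. **Theorem.** For every quantum electromagnetic field $(F_{\mu\nu},U)$ and every covariant path-frame system $\mathcal P$, the pairs $(\mathrm u^{em}_{\mathcal P},U)$, $(\mathrm u^{em}_{\mathcal E},U)$ and $(\mathrm u^{pot},U)$ are causal and covariant connection systems, and $$(\mathrm u^{em}_{\mathcal P},U)\;\cong\;(\mathrm u^{em}_{\mathcal E},U)\;=\;(\mathrm u^{pot},U).$$ The equivalence is realized by $\mathrm g_a(a')=\lambda^{em}\big(p_{(a,a')}\,\bar e_{(a,a')}\big)$, $a'\in\Sigma_0^a$. That is, $\mathrm g$ is a gauge transformation of $(\mathrm u^{em}_{\mathcal E},U)$: $U(P)\,\mathrm g_a(a')\,U(P)^*=\mathrm g_{Pa}(Pa')$ for all $P\in\mathscr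 P$, and conjugation by $\mathrm g_a(a)$ maps onto itself, for each double cone $o$ containing the support of $a$, the norm closed $*$-algebra generated by the values of $\mathrm u^{em}_{\mathcal E}$ on the loops supported in $o$. Moreover $$\mathrm g_a(\partial_0b)\,\mathrm u^{em}_{\mathcal E_a}(b)=\mathrm u^{em}_{\mathcal P_a}(b)\,\mathrm g_a(\partial_1b),\qquad b\in\Sigma_1^a,\ a\in\Sigma_0 .$$ -/

import Mathlib

open MeasureTheory
open scoped SchwartzMap Matrix LineDeriv

namespace EMLoops
noncomputable section

/-- Points of Minkowski spacetime, in coordinates `x = (x⁰, x¹, x², x³)`.  (The sup norm carried by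
this type plays no role: the Schwartz space, supports and Lebesgue measure do not depend on the
choice of a norm.) -/
abbrev Spacetime : Type := Fin 4 → ℝ

/-- The metric tensor, with signature `(+,-,-,-)`. -/
def metric : Matrix (Fin 4) (Fin 4) ℝ := Matrix.diagonal ![1, -1, -1, -1]

/-- The Minkowski inner product `x · y = (x, g y)`. -/
def minkowski (x y : Spacetime) : ℝ := x ⬝ᵥ (metric *ᵥ y)

theorem metric_mul_metric : metric * metric = 1 := by
  rw [metric, Matrix.diagonal_mul_diagonal, ← Matrix.diagonal_one]
  congr 1
  ext i
  fin_cases i <;> simp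

theorem lorentz_cofactor {L : Matrix (Fin 4) (Fin 4) ℝ} (h : Lᵀ * metric * L = metric) :
    L * (metric * Lᵀ * metric) = 1 := by
  rw [mul_eq_one_comm]
  calc metric * Lᵀ * metric * L = metric * (Lᵀ * metric * L) := by simp only [Matrix.mul_assoc]
    _ = 1 := by rw [h, metric_mul_metric]

theorem lorentz_transpose {L : Matrix (Fin 4) (Fin 4) ℝ} (h : Lᵀ * metric * L = metric) :
    L * metric * Lᵀ = metric := by
  have h1 : L * metric * Lᵀ * (metric * metric) = metric := by
    calc L * metric * Lᵀ * (metric * metric) = (L * (metric * Lᵀ * metric)) * metric := by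
          simp only [Matrix.mul_assoc]
      _ = metric := by rw [lorentz_cofactor h, Matrix.one_mul]
  rwa [metric_mul_metric, Matrix.mul_one] at h1

theorem orthochronous_mul {L M : Matrix (Fin 4) (Fin 4) ℝ} (hL : Lᵀ * metric * L = metric)
    (hM : Mᵀ * metric * M = metric) (hL0 : 1 ≤ L 0 0) (hM0 : 1 ≤ M 0 0) : 1 ≤ (L * M) 0 0 := by
  have h1 := congrFun (congrFun (lorentz_transpose hL) 0) 0
  have h2 := congrFun (congrFun hM 0) 0
  simp [metric, Matrix.mul_apply, Fin.sum_univ_four, Matrix.diagonal] at h1 h2 ⊢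
  have key : (L 0 1 * M 1 0 + L 0 2 * M 2 0 + L 0 3 * M 3 0) ^ 2 ≤ (L 0 0 * M 0 0 - 1) ^ 2 := by
    have hcs : (L 0 1 * M 1 0 + L 0 2 * M 2 0 + L 0 3 * M 3 0) ^ 2 ≤
        (L 0 1 ^ 2 + L 0 2 ^ 2 + L 0 3 ^ 2) * (M 1 0 ^ 2 + M 2 0 ^ 2 + M 3 0 ^ 2) := by
      nlinarith [sq_nonneg (L 0 1 * M 2 0 - L 0 2 * M 1 0),
        sq_nonneg (L 0 1 * M 3 0 - L 0 3 * M 1 0), sq_nonneg (L 0 2 * M 3 0 - L 0 3 * M 2 0)]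
    have e1 : L 0 1 ^ 2 + L 0 2 ^ 2 + L 0 3 ^ 2 = L 0 0 ^ 2 - 1 := by linarith
    have e2 : M 1 0 ^ 2 + M 2 0 ^ 2 + M 3 0 ^ 2 = M 0 0 ^ 2 - 1 := by linarith
    rw [e1, e2] at hcs
    nlinarith [sq_nonneg (L 0 0 - M 0 0)]
  have h3 : 0 ≤ L 0 0 * M 0 0 - 1 := by nlinarith
  have := (abs_le.mp (abs_le_of_sq_le_sq key h3)).1
  linarith

/-- The restricted Lorentz group: `Lᵀ g L = g`, `det L > 0`, `L⁰₀ ≥ 1`. -/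
def restrictedLorentz : Subgroup (Matrix.GeneralLinearGroup (Fin 4) ℝ) where
  carrier := {L | (L : Matrix (Fin 4) (Fin 4) ℝ)ᵀ * metric * (L : Matrix (Fin 4) (Fin 4) ℝ) = metric ∧
    0 < (L : Matrix (Fin 4) (Fin 4) ℝ).det ∧ 1 ≤ (L : Matrix (Fin 4) (Fin 4) ℝ) 0 0}
  one_mem' := by simp
  mul_mem' := by
    rintro L M ⟨hL, hLd, hL0⟩ ⟨hM, hMd, hM0⟩
    refine ⟨?_, ?_, ?_⟩
    · rw [Units.val_mul, Matrix.transpose_mul]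
      calc _ = (M : Matrix (Fin 4) (Fin 4) ℝ)ᵀ * ((L : Matrix (Fin 4) (Fin 4) ℝ)ᵀ * metric *
            (L : Matrix (Fin 4) (Fin 4) ℝ)) * (M : Matrix (Fin 4) (Fin 4) ℝ) := by
            simp only [Matrix.mul_assoc]
        _ = metric := by rw [hL, hM]
    · rw [Units.val_mul, Matrix.det_mul]; positivity
    · rw [Units.val_mul]; exact orthochronous_mul hL hM hL0 hM0
  inv_mem' := by
    rintro L ⟨hL, hLd, hL0⟩
    have hinv : ((L⁻¹ : Matrix.GeneralLinearGroup (Fin 4) ℝ) : Matrix (Fin 4) (Fin 4) ℝ) =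
        metric * (L : Matrix (Fin 4) (Fin 4) ℝ)ᵀ * metric :=
      Units.inv_eq_of_mul_eq_one_right (lorentz_cofactor hL)
    have hT : metricᵀ = metric := by simp [metric]
    refine ⟨?_, ?_, ?_⟩
    · rw [hinv]
      simp only [Matrix.transpose_mul, hT, Matrix.transpose_transpose]
      calc _ = metric * (L : Matrix (Fin 4) (Fin 4) ℝ) * (metric * metric) * metric *
            (L : Matrix (Fin 4) (Fin 4) ℝ)ᵀ * metric := by simp only [Matrix.mul_assoc]
        _ = metric * ((L : Matrix (Fin 4) (Fin 4) ℝ) * metric *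
            (L : Matrix (Fin 4) (Fin 4) ℝ)ᵀ) * metric := by
              rw [metric_mul_metric, Matrix.mul_one]; simp only [Matrix.mul_assoc]
        _ = metric := by rw [lorentz_transpose hL, metric_mul_metric, Matrix.one_mul]
    · have := congrArg Matrix.det (L.inv_mul)
      rw [Matrix.det_mul, Matrix.det_one] at this
      exact pos_of_mul_pos_left (by rw [this]; exact one_pos) hLd.le
    · rw [hinv]
      simpa [metric, Matrix.mul_apply, Fin.sum_univ_four, Matrix.diagonal] using hL0

/-- The (proper orthochronous) Poincaré group: pairs `(x, L)`. -/
@[ext]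
structure Poincare where
  trans : Spacetime
  lin : restrictedLorentz

namespace Poincare

/-- The Lorentz matrix `L^μ_ν` of `(x, L)`. -/
def mat (P : Poincare) : Matrix (Fin 4) (Fin 4) ℝ := ((P.lin : Matrix.GeneralLinearGroup (Fin 4) ℝ) : Matrix (Fin 4) (Fin 4) ℝ)

/-- `(x, L) (x', L') = (x + L x', L L')`. -/
instance : Mul Poincare := ⟨fun P Q => ⟨P.trans + P.mat *ᵥ Q.trans, P.lin * Q.lin⟩⟩
instance : One Poincare := ⟨⟨0, 1⟩⟩
instance : Inv Poincare := ⟨fun P => ⟨-(((P.lin⁻¹ : restrictedLorentz) : Matrix.GeneralLinearGroup (Fin 4) ℝ) : Matrix (Fin 4) (Fin 4) ℝ) *ᵥ P.trans, P.lin⁻¹⟩⟩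

instance : Group Poincare := Group.ofLeftAxioms
  (by
    intro P Q R
    refine Poincare.ext ?_ (mul_assoc _ _ _)
    change (P.trans + P.mat *ᵥ Q.trans) + (P.mat * Q.mat) *ᵥ R.trans =
      P.trans + P.mat *ᵥ (Q.trans + Q.mat *ᵥ R.trans)
    rw [Matrix.mulVec_add, Matrix.mulVec_mulVec, add_assoc])
  (by
    intro P
    refine Poincare.ext ?_ (one_mul _)
    change 0 + (1 : Matrix (Fin 4) (Fin 4) ℝ) *ᵥ P.trans = P.trans
    simp)
  (by
    intro P
    refine Poincare.ext ?_ (inv_mul_cancel _)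
    change (P⁻¹).trans + (P⁻¹).mat *ᵥ P.trans = 0
    change -(P⁻¹).mat *ᵥ P.trans + (P⁻¹).mat *ᵥ P.trans = 0
    rw [Matrix.neg_mulVec, neg_add_cancel])

/-- The action on points, `P y = x + L y`. -/
def act (P : Poincare) (x : Spacetime) : Spacetime := P.trans + P.mat *ᵥ x
end Poincare

/-- A restricted Lorentz transformation as a continuous linear automorphism of spacetime. -/
def lorentzCLE (L : restrictedLorentz) : Spacetime ≃L[ℝ] Spacetime :=
  LinearEquiv.toContinuousLinearEquiv
    { Matrix.mulVecLin ((L : Matrix.GeneralLinearGroup (Fin 4) ℝ) : Matrix (Fin 4) (Fin 4) ℝ) with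
      invFun := fun x =>
        ((L⁻¹ : Matrix.GeneralLinearGroup (Fin 4) ℝ) : Matrix (Fin 4) (Fin 4) ℝ) *ᵥ x
      left_inv := fun x => by
        change ((L⁻¹ : Matrix.GeneralLinearGroup (Fin 4) ℝ) : Matrix (Fin 4) (Fin 4) ℝ) *ᵥ
          (((L : Matrix.GeneralLinearGroup (Fin 4) ℝ) : Matrix (Fin 4) (Fin 4) ℝ) *ᵥ x) = x
        rw [Matrix.mulVec_mulVec, Units.inv_mul, Matrix.one_mulVec]
      right_inv := fun x => by
        change ((L : Matrix.GeneralLinearGroup (Fin 4) ℝ) : Matrix (Fin 4) (Fin 4) ℝ) *ᵥ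
          (((L⁻¹ : Matrix.GeneralLinearGroup (Fin 4) ℝ) : Matrix (Fin 4) (Fin 4) ℝ) *ᵥ x) = x
        rw [Matrix.mulVec_mulVec, Units.mul_inv, Matrix.one_mulVec] }

/-! ### Causal structure -/

/-- Causal disjointness `X ⊥ Y`: all points of `X` are spacelike to all points of `Y`. -/
def CausallyDisjoint (X Y : Set Spacetime) : Prop :=
  ∀ x ∈ X, ∀ y ∈ Y, minkowski (x - y) (x - y) < 0

/-- The open forward light cone. -/
def forwardCone : Set Spacetime := {v | 0 < minkowski v v ∧ 0 < v 0}

/-- The closed forward light cone. -/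
def closedForwardCone : Set Spacetime := {v | 0 ≤ minkowski v v ∧ 0 ≤ v 0}

/-- The set of double cones: intersections `(x + V₊) ∩ (y - V₊)` with `y - x ∈ V₊`. -/
def doubleCones : Set (Set Spacetime) :=
  {o | ∃ x y : Spacetime, y - x ∈ forwardCone ∧
    o = {z | z - x ∈ forwardCone ∧ y - z ∈ forwardCone}}

/-! ### Test functions -/

/-- `f_L = f ∘ L⁻¹`. -/
def lorentzTest (L : restrictedLorentz) (f : 𝓢(Spacetime, ℝ)) : 𝓢(Spacetime, ℝ) :=
  SchwartzMap.compCLMOfContinuousLinearEquiv ℝ (lorentzCLE L).symm f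

/-- `f_P = f ∘ P⁻¹`, i.e. `f_{(x, L)}(y) = f (L⁻¹ (y - x))`. -/
def poincareTest (P : Poincare) (f : 𝓢(Spacetime, ℝ)) : 𝓢(Spacetime, ℝ) :=
  SchwartzMap.compSubConstCLM ℝ P.trans (lorentzTest P.lin f)

theorem poincareTest_apply (P : Poincare) (f : 𝓢(Spacetime, ℝ)) (y : Spacetime) :
    poincareTest P f y = f ((P⁻¹).act y) := by
  change f ((P⁻¹).mat *ᵥ (y - P.trans)) = f (-(P⁻¹).mat *ᵥ P.trans + (P⁻¹).mat *ᵥ y)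
  rw [Matrix.mulVec_sub, Matrix.neg_mulVec, sub_eq_neg_add]

/-! ### Unitary exponentials of unbounded self-adjoint operators -/

section Operators

variable {H : Type*} [NormedAddCommGroup H] [InnerProductSpace ℂ H] [CompleteSpace H]

/-- Strongly continuous one-parameter unitary groups. -/
structure IsUnitaryGroup (V : ℝ → unitary (H →L[ℂ] H)) : Prop where
  zero : V 0 = 1
  add : ∀ s t, V (s + t) = V s * V t
  cont : ∀ ψ : H, Continuous fun t => (V t : H →L[ℂ] H) ψ

/-- `A` is the self-adjoint generator of `V`, i.e. `V t = exp (i t A)`: the domain of `A` consists of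
the vectors `ψ` such that `t ↦ V t ψ` is differentiable at `0`, and the derivative is `i A ψ`. -/
def IsGenerator (V : ℝ → unitary (H →L[ℂ] H)) (A : H →ₗ.[ℂ] H) : Prop :=
  ∀ ψ φ : H, (ψ, φ) ∈ A.graph ↔
    HasDerivAt (fun t : ℝ => (V t : H →L[ℂ] H) ψ) (Complex.I • φ) 0

open Classical in
/-- The unitary operator `exp (i A)` of a self-adjoint operator `A`: the value at `t = 1` of the
one-parameter unitary group generated by `A`.  By Stone's theorem this group exists for every
self-adjoint `A`, and by `IsGenerator.unique` it is unique. -/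
def expI (A : H →ₗ.[ℂ] H) : unitary (H →L[ℂ] H) :=
  if h : ∃ V : ℝ → unitary (H →L[ℂ] H), IsUnitaryGroup V ∧ IsGenerator V A then
    h.choose 1 else 1

theorem unitary_mul_apply (u v : unitary (H →L[ℂ] H)) (ψ : H) :
    ((u * v : unitary (H →L[ℂ] H)) : H →L[ℂ] H) ψ = (u : H →L[ℂ] H) ((v : H →L[ℂ] H) ψ) := rfl

theorem IsGenerator.unique {V W : ℝ → unitary (H →L[ℂ] H)} {A : H →ₗ.[ℂ] H}
    (hA : Dense (A.domain : Set H)) (hV : IsUnitaryGroup V) (hVA : IsGenerator V A)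
    (hW : IsUnitaryGroup W) (hWA : IsGenerator W A) : V = W := by
  have hinv : ∀ (ψ : H), ψ ∈ A.domain → ∀ t : ℝ, (W t : H →L[ℂ] H) ψ ∈ A.domain := by
    intro ψ hψ t
    have h1 := (hWA ψ (A ⟨ψ, hψ⟩)).1 (A.mem_graph ⟨ψ, hψ⟩)
    have h2 := ((W t : H →L[ℂ] H).restrictScalars ℝ).hasFDerivAt.comp_hasDerivAt (0 : ℝ) h1
    have h3 : ((W t : H →L[ℂ] H) ψ, (W t : H →L[ℂ] H) (A ⟨ψ, hψ⟩)) ∈ A.graph := by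
      rw [hWA]
      convert h2 using 1
      · ext s
        simp only [Function.comp, ContinuousLinearMap.coe_restrictScalars']
        rw [← unitary_mul_apply, ← unitary_mul_apply, ← hW.add, ← hW.add, add_comm]
      · simp
    exact LinearPMap.mem_domain_of_mem_graph h3
  have key : ∀ ψ ∈ A.domain, ∀ t : ℝ, HasDerivAt (fun t : ℝ =>
      (V (-t) : H →L[ℂ] H) ((W t : H →L[ℂ] H) ψ)) 0 t := by
    intro ψ hψ t
    set χ := (W t : H →L[ℂ] H) ψ with hχ
    have hχd : χ ∈ A.domain := hinv ψ hψ t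
    have h3 := ((hWA χ (A ⟨χ, hχd⟩)).1 (A.mem_graph ⟨χ, hχd⟩)).sub
      ((hVA χ (A ⟨χ, hχd⟩)).1 (A.mem_graph ⟨χ, hχd⟩))
    rw [sub_self, hasDerivAt_iff_isLittleO_nhds_zero] at h3
    rw [hasDerivAt_iff_isLittleO_nhds_zero]
    refine (Asymptotics.IsBigO.of_bound 1 (Filter.Eventually.of_forall fun s => ?_)).trans_isLittleO h3
    simp only [one_mul, zero_add, Pi.sub_apply, smul_zero, sub_zero, hV.zero, hW.zero, sub_self]
    have e1 : (W (t + s) : H →L[ℂ] H) ψ = (W s : H →L[ℂ] H) χ := by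
      rw [add_comm, hW.add, unitary_mul_apply]
    have e2 : (V (-t) : H →L[ℂ] H) χ = (V (-(t + s)) : H →L[ℂ] H) ((V s : H →L[ℂ] H) χ) := by
      rw [← unitary_mul_apply (V (-(t + s))), ← hV.add]; congr 3; ring
    rw [e1, e2, ← map_sub]
    exact ((Unitary.linearIsometryEquiv (V (-(t + s)))).norm_map _).le
  funext t
  have hag : ∀ ψ ∈ A.domain, (V t : H →L[ℂ] H) ψ = (W t : H →L[ℂ] H) ψ := by
    intro ψ hψ
    have hc := is_const_of_deriv_eq_zero (fun s => (key ψ hψ s).differentiableAt)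
      (fun s => (key ψ hψ s).deriv) t 0
    simp only [neg_zero, hV.zero, hW.zero] at hc
    have := congrArg (V t : H →L[ℂ] H) hc
    rw [← unitary_mul_apply, ← hV.add, add_neg_cancel, hV.zero] at this
    simpa using this.symm
  apply Subtype.ext
  exact ContinuousLinearMap.coeFn_injective <| Continuous.ext_on hA
    (V t : H →L[ℂ] H).continuous (W t : H →L[ℂ] H).continuous hag

theorem expI_eq {V : ℝ → unitary (H →L[ℂ] H)} {A : H →ₗ.[ℂ] H}
    (hA : Dense (A.domain : Set H)) (hV : IsUnitaryGroup V) (hVA : IsGenerator V A) :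
    expI A = V 1 := by
  have h : ∃ V : ℝ → unitary (H →L[ℂ] H), IsUnitaryGroup V ∧ IsGenerator V A := ⟨V, hV, hVA⟩
  rw [expI, dif_pos h]
  exact congrFun (IsGenerator.unique hA h.choose_spec.1 h.choose_spec.2 hV hVA) 1

/-- A linear operator defined on a dense domain is essentially self-adjoint if its closure is
self-adjoint. -/
def EssentiallySelfAdjoint (A : H →ₗ.[ℂ] H) : Prop :=
  Dense (A.domain : Set H) ∧ A.IsClosable ∧ IsSelfAdjoint A.closure

end Operators

/-! ### The quantum electromagnetic field -/

/-- The operator `F_{μν}(T^{μν})` (sum over `μ, ν`), with domain `D`. -/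
def contraction {H : Type*} [NormedAddCommGroup H] [InnerProductSpace ℂ H] {D : Submodule ℂ H}
    (F : Fin 4 → Fin 4 → 𝓢(Spacetime, ℝ) →ₗ[ℝ] (D →ₗ[ℂ] D))
    (T : Fin 4 → Fin 4 → 𝓢(Spacetime, ℝ)) : H →ₗ.[ℂ] H :=
  ⟨D, D.subtype ∘ₗ ∑ μ, ∑ ν, F μ ν (T μ ν)⟩

/-- The operator `F_{μν}(f)` for a single pair of indices, with domain `D`. -/
def component {H : Type*} [NormedAddCommGroup H] [InnerProductSpace ℂ H] {D : Submodule ℂ H}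
    (F : Fin 4 → Fin 4 → 𝓢(Spacetime, ℝ) →ₗ[ℝ] (D →ₗ[ℂ] D))
    (μ ν : Fin 4) (f : 𝓢(Spacetime, ℝ)) : H →ₗ.[ℂ] H :=
  ⟨D, D.subtype ∘ₗ F μ ν f⟩

/-- The quantum electromagnetic field `(F_{μν}, U)` on the Hilbert space `H`.  The field need not
be free: the second Maxwell equation `∂^μ F_{μν} = J_ν` only defines the current `J_ν` and imposes
no condition.  No continuity of `U` is required. -/
structure QuantumEMField (H : Type*) [NormedAddCommGroup H] [InnerProductSpace ℂ H]
    [CompleteSpace H] where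
  /-- The unitary representation of the Poincaré group. -/
  U : Poincare →* unitary (H →L[ℂ] H)
  /-- The vacuum vector. -/
  Ω : H
  norm_vacuum : ‖Ω‖ = 1
  vacuum_invariant : ∀ P, (U P : H →L[ℂ] H) Ω = Ω
  /-- Uniqueness of the vacuum, up to a scalar factor. -/
  vacuum_unique : ∀ ψ : H, (∀ P, (U P : H →L[ℂ] H) ψ = ψ) → ∃ z : ℂ, ψ = z • Ω
  /-- The spectrum condition: the spectral measures of the translations `U (x) = exp (i p · x)` are
  concentrated on the closed forward cone. -/
  spectrum : ∀ ψ : H, ∃ m : Measure Spacetime, IsFiniteMeasure m ∧ m closedForwardConeᶜ = 0 ∧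
    ∀ x : Spacetime, inner ℂ ψ ((U ⟨x, 1⟩ : H →L[ℂ] H) ψ) =
      ∫ p, Complex.exp (Complex.I * (minkowski p x : ℂ)) ∂m
  /-- The common domain of the field operators. -/
  D : Submodule ℂ H
  dense_D : Dense (D : Set H)
  vacuum_mem : Ω ∈ D
  /-- The field operators `F_{μν}(f)`, linear in the test function `f`, mapping `D` into `D`. -/
  F : Fin 4 → Fin 4 → 𝓢(Spacetime, ℝ) →ₗ[ℝ] (D →ₗ[ℂ] D)
  /-- Matrix elements of the field are tempered distributions. -/
  tempered : ∀ (μ ν : Fin 4) (φ ψ : D),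
    Continuous fun f : 𝓢(Spacetime, ℝ) => inner ℂ (φ : H) (F μ ν f ψ : H)
  /-- Contractions of the field with real 2-tensors of test functions are essentially self-adjoint
  on `D`.  (Tensors with only one nonzero entry, or only one nonzero row, give this for
  `F_{μν}(f)` and for the contractions `F_{μν}(T^ν)` with 1-tensors.) -/
  essentiallySelfAdjoint : ∀ T : Fin 4 → Fin 4 → 𝓢(Spacetime, ℝ),
    EssentiallySelfAdjoint (contraction F T)
  U_mem_D : ∀ (P : Poincare) (ψ : D), (U P : H →L[ℂ] H) ψ ∈ D
  /-- Covariance: `U F_{μν}(f) U* = (L⁻¹)_μ^α (L⁻¹)_ν^β F_{αβ}(f_P)` on `D`, where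
  `(L⁻¹)_μ^α = L^α_μ`. -/
  covariance : ∀ (P : Poincare) (μ ν : Fin 4) (f : 𝓢(Spacetime, ℝ)) (ψ : D),
    (U P : H →L[ℂ] H) (F μ ν f ψ : H) =
      ∑ α, ∑ β, (P.mat α μ * P.mat β ν) • (F α β (poincareTest P f) ⟨_, U_mem_D P ψ⟩ : H)
  /-- Strong causality. -/
  causality : ∀ (μ ν α β : Fin 4) (f g : 𝓢(Spacetime, ℝ)),
    CausallyDisjoint (tsupport f) (tsupport g) →
      Commute (expI (component F μ ν f).closure) (expI (component F α β g).closure)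
  antisymm : ∀ (μ ν : Fin 4) (f : 𝓢(Spacetime, ℝ)), F μ ν f = -F ν μ f
  /-- The first Maxwell equation, in the weak sense. -/
  maxwell : ∀ (σ μ ν : Fin 4) (f : 𝓢(Spacetime, ℝ)),
    F μ ν (∂_{(Pi.single σ 1 : Spacetime)} f) + F ν σ (∂_{(Pi.single μ 1 : Spacetime)} f) +
      F σ μ (∂_{(Pi.single ν 1 : Spacetime)} f) = 0

/-! ### Averages of translates of test functions -/

section Averages

variable {M : Type} [NormedAddCommGroup M] [NormedSpace ℝ M]
  {E : Type} [NormedAddCommGroup E] [NormedSpace ℝ E]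

/-- `x ↦ ∫_K w(t) f (x - c(t)) dt`. -/
def avgFun (K : Set (ℝ × ℝ)) (w : ℝ × ℝ → ℝ) (c : ℝ × ℝ → M) (f : M → E) (x : M) : E :=
  ∫ t in K, w t • f (x - c t)

theorem avg_intble {K : Set (ℝ × ℝ)} (hK : IsCompact K) {w : ℝ × ℝ → ℝ} (hw : Continuous w)
    {c : ℝ × ℝ → M} (hc : Continuous c) (f : 𝓢(M, E)) (x : M) :
    IntegrableOn (fun t => w t • f (x - c t)) K :=
  ContinuousOn.integrableOn_compact hK (by
    have := f.continuous
    fun_prop)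

theorem avg_hasFDerivAt {K : Set (ℝ × ℝ)} (hK : IsCompact K) {w : ℝ × ℝ → ℝ} (hw : Continuous w)
    {c : ℝ × ℝ → M} (hc : Continuous c) (f : 𝓢(M, E)) (x : M) :
    HasFDerivAt (avgFun K w c f) (avgFun K w c (SchwartzMap.fderivCLM ℝ M E f) x) x := by
  obtain ⟨C, hC⟩ := (SchwartzMap.fderivCLM ℝ M E f).decay 0 0
  have hC' : ∀ y, ‖SchwartzMap.fderivCLM ℝ M E f y‖ ≤ C := by
    intro y; simpa using hC.2 y
  refine hasFDerivAt_integral_of_dominated_of_fderiv_le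
    (F := fun y t => w t • f (y - c t))
    (F' := fun y t => w t • SchwartzMap.fderivCLM ℝ M E f (y - c t))
    (bound := fun t => ‖w t‖ * C) (s := Set.univ) Filter.univ_mem ?_ ?_ ?_ ?_ ?_ ?_
  · exact Filter.Eventually.of_forall fun y => (avg_intble hK hw hc f y).aestronglyMeasurable
  · exact avg_intble hK hw hc f x
  · exact (avg_intble hK hw hc _ x).aestronglyMeasurable
  · refine Filter.Eventually.of_forall fun t y _ => ?_
    rw [norm_smul]
    exact mul_le_mul_of_nonneg_left (hC' _) (norm_nonneg _)
  · exact ContinuousOn.integrableOn_compact hK (by fun_prop)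
  · refine Filter.Eventually.of_forall fun t y _ => ?_
    have h1 : HasFDerivAt (fun y : M => y - c t) (ContinuousLinearMap.id ℝ M) y :=
      (hasFDerivAt_id y).sub_const _
    have h2 : HasFDerivAt f (SchwartzMap.fderivCLM ℝ M E f (y - c t)) (y - c t) := by
      rw [SchwartzMap.fderivCLM_apply]
      exact f.differentiableAt.hasFDerivAt
    exact (h2.comp y h1).const_smul (w t)

theorem avg_contDiff {K : Set (ℝ × ℝ)} (hK : IsCompact K) {w : ℝ × ℝ → ℝ} (hw : Continuous w)
    {c : ℝ × ℝ → M} (hc : Continuous c) (n : ℕ) :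
    ∀ {E : Type} [NormedAddCommGroup E] [NormedSpace ℝ E] (f : 𝓢(M, E)),
      ContDiff ℝ n (avgFun K w c f) := by
  induction n with
  | zero =>
    intro E _ _ f
    exact contDiff_zero.2 (continuous_iff_continuousAt.2 fun x =>
      (avg_hasFDerivAt hK hw hc f x).continuousAt)
  | succ n ih =>
    intro E _ _ f
    rw [Nat.cast_succ, contDiff_succ_iff_hasFDerivAt]
    exact ⟨_, ih (SchwartzMap.fderivCLM ℝ M E f), avg_hasFDerivAt hK hw hc f⟩

theorem avg_decay {K : Set (ℝ × ℝ)} (hK : IsCompact K) {w : ℝ × ℝ → ℝ} (hw : Continuous w)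
    {c : ℝ × ℝ → M} (hc : Continuous c) (k n : ℕ) :
    ∀ {E : Type} [NormedAddCommGroup E] [NormedSpace ℝ E] (f : 𝓢(M, E)),
      ∃ C : ℝ, ∀ x, ‖x‖ ^ k * ‖iteratedFDeriv ℝ n (avgFun K w c f) x‖ ≤ C := by
  induction n with
  | zero =>
    intro E _ _ f
    obtain ⟨R, hR⟩ := hK.exists_bound_of_continuousOn hc.continuousOn
    obtain ⟨A, -, hA⟩ := f.decay k 0
    obtain ⟨B, -, hB⟩ := f.decay 0 0
    simp only [norm_iteratedFDeriv_zero, pow_zero, one_mul] at hA hB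
    refine ⟨∫ t in K, ‖w t‖ * (2 ^ (k - 1) * (A + R ^ k * B)), fun x => ?_⟩
    rw [norm_iteratedFDeriv_zero]
    calc ‖x‖ ^ k * ‖avgFun K w c f x‖ ≤ ‖x‖ ^ k * ∫ t in K, ‖w t • f (x - c t)‖ := by
          gcongr; exact norm_integral_le_integral_norm _
      _ = ∫ t in K, ‖x‖ ^ k * ‖w t • f (x - c t)‖ := by rw [integral_const_mul]
      _ ≤ _ := by
        refine setIntegral_mono_on ?_ ?_ hK.measurableSet ?_
        · exact ((avg_intble hK hw hc f x).norm).const_mul _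
        · exact ContinuousOn.integrableOn_compact hK (by fun_prop)
        · intro t ht
          have hct := hR t ht
          rw [norm_smul, mul_left_comm]
          refine mul_le_mul_of_nonneg_left ?_ (norm_nonneg _)
          have h1 : ‖x‖ ≤ ‖x - c t‖ + R := by
            calc ‖x‖ = ‖(x - c t) + c t‖ := by simp
              _ ≤ _ := (norm_add_le _ _).trans (by gcongr)
          have hR0 : 0 ≤ R := (norm_nonneg _).trans hct
          calc ‖x‖ ^ k * ‖f (x - c t)‖ ≤ (‖x - c t‖ + R) ^ k * ‖f (x - c t)‖ := by gcongr
            _ ≤ (2 ^ (k - 1) * (‖x - c t‖ ^ k + R ^ k)) * ‖f (x - c t)‖ := by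
              gcongr; exact add_pow_le (norm_nonneg _) hR0 k
            _ = 2 ^ (k - 1) * (‖x - c t‖ ^ k * ‖f (x - c t)‖ + R ^ k * ‖f (x - c t)‖) := by ring
            _ ≤ _ := by gcongr; exacts [hA _, hB _]
  | succ n ih =>
    intro E _ _ f
    obtain ⟨C, hC⟩ := ih (SchwartzMap.fderivCLM ℝ M E f)
    refine ⟨C, fun x => ?_⟩
    rw [← norm_iteratedFDeriv_fderiv]
    have : fderiv ℝ (avgFun K w c f) = avgFun K w c (SchwartzMap.fderivCLM ℝ M E f) := by
      ext1 x; exact (avg_hasFDerivAt hK hw hc f x).fderiv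
    rw [this]; exact hC x

/-- The Schwartz function `x ↦ ∫_K w(t) f (x - c(t)) dt`. -/
def schwartzAvg (K : Set (ℝ × ℝ)) (hK : IsCompact K) (w : ℝ × ℝ → ℝ) (hw : Continuous w)
    (c : ℝ × ℝ → M) (hc : Continuous c) (f : 𝓢(M, ℝ)) : 𝓢(M, ℝ) where
  toFun x := ∫ t in K, w t * f (x - c t)
  smooth' := contDiff_infty.2 fun n => avg_contDiff hK hw hc n f
  decay' k n := avg_decay hK hw hc k n f

end Averages

/-! ### Affine smearing simplices -/

/-- Smearing functions: real Schwartz functions `f` with `0 ∈ supp f`. -/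
@[ext]
structure Smearing where
  fn : 𝓢(Spacetime, ℝ)
  zero_mem : (0 : Spacetime) ∈ tsupport fn

/-- `f ↦ f_L` on smearing functions. -/
def Smearing.lorentz (L : restrictedLorentz) (f : Smearing) : Smearing where
  fn := lorentzTest L f.fn
  zero_mem := by
    have h := tsupport_comp_eq_preimage f.fn (lorentzCLE L).symm.toHomeomorph
    change (0 : Spacetime) ∈ tsupport (f.fn ∘ (lorentzCLE L).symm.toHomeomorph)
    rw [h]
    change (lorentzCLE L).symm 0 ∈ tsupport f.fn
    rw [map_zero]
    exact f.zero_mem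

/-- An affine smearing `n`-simplex `(s_0, …, s_n; f)`, given by its vertices and its smearing
function. -/
@[ext]
structure Simplex (n : ℕ) where
  vtx : Fin (n + 1) → Spacetime
  smear : Smearing

/-- The faces `∂_i`: omit the vertex `s_i`. -/
def Simplex.face {n : ℕ} (i : Fin (n + 2)) (s : Simplex (n + 1)) : Simplex n :=
  ⟨fun j => s.vtx (i.succAbove j), s.smear⟩

/-- A simplex is degenerated if two of its vertices coincide. -/
def Simplex.Degenerated {n : ℕ} (s : Simplex n) : Prop := ∃ i j, i ≠ j ∧ s.vtx i = s.vtx j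

/-- The Poincaré action `P (χ, f) = (P χ, f_L)`. -/
def Simplex.move {n : ℕ} (P : Poincare) (s : Simplex n) : Simplex n :=
  ⟨fun j => P.act (s.vtx j), s.smear.lorentz P.lin⟩

/-- The opposite of a 1-simplex. -/
def Simplex.opp (b : Simplex 1) : Simplex 1 := ⟨![b.vtx 1, b.vtx 0], b.smear⟩

/-- `Σ_n^a`, the `n`-simplices with the same smearing function as the 0-simplex `a`. -/
def Component (n : ℕ) (a : Simplex 0) : Type := {s : Simplex n // s.smear = a.smear}

namespace Component

/-- The 0-simplex `a` as an element of `Σ_0^a`. -/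
def base (a : Simplex 0) : Component 0 a := ⟨a, rfl⟩

/-- Faces of elements of `Σ_n^a`. -/
def face {n : ℕ} {a : Simplex 0} (i : Fin (n + 2)) (s : Component (n + 1) a) : Component n a :=
  ⟨s.1.face i, s.2⟩

/-- Opposites of elements of `Σ_1^a`. -/
def opp {a : Simplex 0} (b : Component 1 a) : Component 1 a := ⟨b.1.opp, b.2⟩

/-- The Poincaré action `Σ_n^a → Σ_n^{Pa}`. -/
def move {n : ℕ} {a : Simplex 0} (P : Poincare) (s : Component n a) : Component n (a.move P) :=
  ⟨s.1.move P, congrArg (Smearing.lorentz P.lin) s.2⟩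

end Component

/-- The 1-simplex `e_{(a', a)}`, the segment from `a` to `a'`. -/
def segment (a : Simplex 0) (a' : Component 0 a) : Simplex 1 :=
  ⟨![a.vtx 0, a'.1.vtx 0], a.smear⟩

/-- The trivial loop `e_a`. -/
def trivialLoop (a : Simplex 0) : Simplex 1 := ⟨![a.vtx 0, a.vtx 0], a.smear⟩

/-- The support of a smearing 0-simplex `(x, f)`, i.e. of the function `f(· - x)`. -/
def supp₀ (a : Simplex 0) : Set Spacetime :=
  tsupport fun x : Spacetime => a.smear.fn (x - a.vtx 0)

/-- The parametrization `r_b` of a 1-simplex. -/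
def line (b : Simplex 1) (s : ℝ) : Spacetime := b.vtx 0 + s • (b.vtx 1 - b.vtx 0)

/-- The support of a smearing 1-simplex `b = (r_b, f)`, i.e. of the 1-form
`x ↦ ∫₀¹ f (x - r_b(s)) r_b'(s)^μ ds`. -/
def supp₁ (b : Simplex 1) : Set Spacetime :=
  tsupport fun x : Spacetime => fun μ : Fin 4 =>
    ∫ s in (0 : ℝ)..1, b.smear.fn (x - line b s) * (b.vtx 1 - b.vtx 0) μ

/-! ### Words, paths, loops and path-frames -/

/-- Words in the 1-simplices.  The list `[b_n, …, b_1]` stands for `b_n ⋯ b_1`. -/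
abbrev Word : Type := List (Simplex 1)

/-- The opposite word `b̄_1 ⋯ b̄_n` of `b_n ⋯ b_1`. -/
def Word.opp (w : Word) : Word := (w.map Simplex.opp).reverse

/-- `IsPath w a a'`: the word `w = b_n ⋯ b_1` is a path `w : a → a'`, that is
`∂_1 b_1 = a`, `∂_0 b_i = ∂_1 b_{i+1}` and `∂_0 b_n = a'`. -/
inductive IsPath : Word → Simplex 0 → Simplex 0 → Prop
  | single (b : Simplex 1) : IsPath [b] (b.face 1) (b.face 0)
  | cons (b : Simplex 1) {w : Word} {a : Simplex 0} :
      IsPath w a (b.face 1) → IsPath (b :: w) a (b.face 0)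

theorem IsPath.append {p q : Word} {o o' o'' : Simplex 0} (hp : IsPath p o o')
    (hq : IsPath q o' o'') : IsPath (q ++ p) o o'' := by
  induction hq with
  | single b => exact IsPath.cons b hp
  | cons b _ ih => exact IsPath.cons b (ih hp)

theorem Simplex.opp_face_zero (b : Simplex 1) : b.opp.face 0 = b.face 1 := by
  ext j
  · fin_cases j; rfl
  · rfl

theorem Simplex.opp_face_one (b : Simplex 1) : b.opp.face 1 = b.face 0 := by
  ext j
  · fin_cases j; rfl
  · rfl

theorem IsPath.single_opp (b : Simplex 1) : IsPath [b.opp] (b.face 0) (b.face 1) := by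
  have h := IsPath.single b.opp
  rwa [b.opp_face_zero, b.opp_face_one] at h

theorem IsPath.opp {p : Word} {o o' : Simplex 0} (hp : IsPath p o o') :
    IsPath (Word.opp p) o' o := by
  induction hp with
  | single b => exact IsPath.single_opp b
  | cons b _ ih =>
    have h := (IsPath.single_opp b).append ih
    simpa [Word.opp] using h

/-- Loops over `a`. -/
def Loop (a : Simplex 0) : Type := {w : Word // IsPath w a a}

/-- A covariant path-frame system: for every pole `a` and every `a' ∈ Σ_0^a` a path
`p_{(a, a')} : a' → a`, with `p_{(a, a)} = e_a` and `P p_{(a, a')} = p_{(Pa, Pa')}`. -/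
structure PathFrameSystem where
  path : (a : Simplex 0) → Component 0 a → Word
  isPath : ∀ (a : Simplex 0) (a' : Component 0 a), IsPath (path a a') a'.1 a
  path_self : ∀ a : Simplex 0, path a (Component.base a) = [trivialLoop a]
  covariant : ∀ (P : Poincare) (a : Simplex 0) (a' : Component 0 a),
    (path a a').map (Simplex.move P) = path (a.move P) (a'.move P)

theorem isPath_segment_opp (a : Simplex 0) (a' : Component 0 a) :
    IsPath [(segment a a').opp] a'.1 a := by
  have h0 : (segment a a').face 0 = a'.1 := by
    ext j
    · fin_cases j; rfl
    · change a.smear.fn _ = a'.1.smear.fn _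
      rw [a'.2]
  have h1 : (segment a a').face 1 = a := by
    ext j
    · fin_cases j; rfl
    · rfl
  have h := IsPath.single_opp (segment a a')
  rwa [h0, h1] at h

theorem trivialLoop_opp (a : Simplex 0) : (segment a (Component.base a)).opp = trivialLoop a := rfl

/-- The Euclidean path-frame system, `p_{(a, a')} = e_{(a, a')}`, the segment from `a'` to `a`. -/
def euclidean : PathFrameSystem where
  path a a' := [(segment a a').opp]
  isPath := isPath_segment_opp
  path_self _ := rfl
  covariant P a a' := by
    simp only [List.map_cons, List.map_nil, List.cons.injEq, and_true]
    ext j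
    · fin_cases j <;> rfl
    · rfl

/-! ### Reduced words and the loops of a double cone -/

open Classical in
/-- The reduced word of a word: degenerated 1-simplices and pairs `b b̄` are removed. -/
def reduce : Word → Word
  | [] => []
  | b :: w =>
    if b.Degenerated then reduce w
    else match reduce w with
      | [] => [b]
      | b' :: w' => if b' = b.opp then w' else b :: b' :: w'

/-- The support `|w|` of a word: the union of the supports of the letters of its reduced word. -/
def wordSupport (w : Word) : Set Spacetime := ⋃ b ∈ reduce w, supp₁ b

/-! ### Integrals of the field and of the potential form -/

/-- The parametrization `σ_c(t) = c_0 + t_1 (c_1 - c_0) + t_2 (c_2 - c_0)` of a 2-simplex. -/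
def triangle (c : Simplex 2) (t : ℝ × ℝ) : Spacetime :=
  c.vtx 0 + (t.1 • (c.vtx 1 - c.vtx 0) + t.2 • (c.vtx 2 - c.vtx 0))

/-- The standard 2-simplex. -/
def Δ₂ : Set (ℝ × ℝ) := {t | 0 ≤ t.1 ∧ 0 ≤ t.2 ∧ t.1 + t.2 ≤ 1}

theorem isCompact_Δ₂ : IsCompact Δ₂ := by
  refine (isCompact_Icc (a := ((0 : ℝ), (0 : ℝ))) (b := (1, 1))).of_isClosed_subset ?_ ?_
  · simp only [Δ₂, Set.ofPred_and]
    exact (isClosed_le (by fun_prop) (by fun_prop)).inter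
      ((isClosed_le (by fun_prop) (by fun_prop)).inter (isClosed_le (by fun_prop) (by fun_prop)))
  · rintro ⟨x, y⟩ ⟨h1, h2, h3⟩
    simp only at h1 h2 h3
    exact ⟨⟨h1, h2⟩, ⟨by linarith, by linarith⟩⟩

/-- The surface element
`σ^{μν} = ∂σ^μ/∂t_1 ∂σ^ν/∂t_2 - ∂σ^μ/∂t_2 ∂σ^ν/∂t_1` of `σ = σ_c`. -/
def surfaceElement (c : Simplex 2) (μ ν : Fin 4) (t : ℝ × ℝ) : ℝ :=
  deriv (fun r => triangle c (r, t.2) μ) t.1 * deriv (fun r => triangle c (t.1, r) ν) t.2 -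
    deriv (fun r => triangle c (t.1, r) μ) t.2 * deriv (fun r => triangle c (r, t.2) ν) t.1

theorem surfaceElement_eq (c : Simplex 2) (μ ν : Fin 4) (t : ℝ × ℝ) :
    surfaceElement c μ ν t = (c.vtx 1 - c.vtx 0) μ * (c.vtx 2 - c.vtx 0) ν -
      (c.vtx 2 - c.vtx 0) μ * (c.vtx 1 - c.vtx 0) ν := by
  have h1 : ∀ (κ : Fin 4) (s r : ℝ),
      deriv (fun r => triangle c (r, s) κ) r = (c.vtx 1 - c.vtx 0) κ := by
    intro κ s r
    simp [triangle]
  have h2 : ∀ (κ : Fin 4) (s r : ℝ),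
      deriv (fun r => triangle c (s, r) κ) r = (c.vtx 2 - c.vtx 0) κ := by
    intro κ s r
    simp [triangle]
  simp only [surfaceElement, h1, h2]

theorem continuous_surfaceElement (c : Simplex 2) (μ ν : Fin 4) :
    Continuous (surfaceElement c μ ν) := by
  rw [funext (surfaceElement_eq c μ ν)]
  exact continuous_const

theorem continuous_triangle (c : Simplex 2) : Continuous (triangle c) := by
  unfold triangle
  fun_prop

/-- The 2-form `σ[f]^{μν}(x) = ∫_{Δ_2} f (x - σ(t)) σ^{μν}(t) d²t` of a 2-simplex `c = (σ, f)`. -/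
def surfaceForm (c : Simplex 2) (μ ν : Fin 4) : 𝓢(Spacetime, ℝ) :=
  schwartzAvg Δ₂ isCompact_Δ₂ (surfaceElement c μ ν) (continuous_surfaceElement c μ ν)
    (triangle c) (continuous_triangle c) c.smear.fn

theorem continuous_line (b : Simplex 1) : Continuous (line b) := by
  unfold line
  fun_prop

/-- The 2-tensor
`γ^{z,μν}_f(x) = ∫₀¹ ∫₀¹ (γ(s) - z)^μ t f (x - z - t (γ(s) - z)) γ'(s)^ν dt ds`
of a 1-simplex `b = (γ, f)` and a pole `z`.  The integration variable is `(s, t) ∈ [0,1]²`, and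
`γ' = b_1 - b_0`. -/
def lineTensor (z : Spacetime) (b : Simplex 1) (μ ν : Fin 4) : 𝓢(Spacetime, ℝ) :=
  schwartzAvg (Set.Icc (0 : ℝ) 1 ×ˢ Set.Icc (0 : ℝ) 1) (isCompact_Icc.prod isCompact_Icc)
    (fun r => (line b r.1 - z) μ * r.2 * (b.vtx 1 - b.vtx 0) ν)
    (by have := continuous_line b; fun_prop)
    (fun r => z + r.2 • (line b r.1 - z)) (by have := continuous_line b; fun_prop) b.smear.fn

/-- The cone construction `h^a(b)`: the 2-simplex with vertices `a_0, b_0, b_1`. -/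
def cone (a : Simplex 0) (b : Simplex 1) : Simplex 2 :=
  ⟨![a.vtx 0, b.vtx 0, b.vtx 1], b.smear⟩

/-- The parametric form of the cone construction. -/
theorem triangle_cone (a : Simplex 0) (b : Simplex 1) (t : ℝ × ℝ) (ht : t.1 + t.2 ≠ 0) :
    triangle (cone a b) t =
      (t.1 + t.2) • line b (t.2 / (t.1 + t.2)) + (1 - (t.1 + t.2)) • a.vtx 0 := by
  ext μ
  simp [triangle, cone, line]
  field_simp
  ring

namespace QuantumEMField

variable {H : Type*} [NormedAddCommGroup H] [InnerProductSpace ℂ H] [CompleteSpace H]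

/-- The surface integral `F⟨σ_c, f⟩ = ½ F_{μν}(σ[f]^{μν})`, as an operator with domain `D`. -/
def surfaceIntegral (𝔽 : QuantumEMField H) (c : Simplex 2) : H →ₗ.[ℂ] H :=
  contraction 𝔽.F fun μ ν => (1 / 2 : ℝ) • surfaceForm c μ ν

/-- The line integral `A^z⟨r_b, f⟩ = F_{μν}(γ^{z,μν}_f)` of the potential form with pole `z`, as an
operator with domain `D`. -/
def lineIntegral (𝔽 : QuantumEMField H) (z : Spacetime) (b : Simplex 1) : H →ₗ.[ℂ] H :=
  contraction 𝔽.F fun μ ν => lineTensor z b μ ν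

/-- The electromagnetic 2-cochain `w^em(c) = exp (i F⟨σ_c, f⟩)`. -/
def wEm (𝔽 : QuantumEMField H) (c : Simplex 2) : unitary (H →L[ℂ] H) :=
  expI (𝔽.surfaceIntegral c).closure

/-- `λ^em(p) = w^em(h^a(b_n)) ⋯ w^em(h^a(b_1))` for a loop `p = b_n ⋯ b_1 : a → a`. -/
def lambdaEm (𝔽 : QuantumEMField H) {a : Simplex 0} (p : Loop a) : unitary (H →L[ℂ] H) :=
  (p.1.map fun b => 𝔽.wEm (cone a b)).prod

end QuantumEMField

/-! ### Connection systems and gauge transformations -/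

section Connections

variable {H : Type*} [NormedAddCommGroup H] [InnerProductSpace ℂ H] [CompleteSpace H]

/-- Families of maps `u_a : Σ_1^a → U(H)`. -/
abbrev Family (H : Type*) [NormedAddCommGroup H] [InnerProductSpace ℂ H] [CompleteSpace H] :
    Type _ :=
  (a : Simplex 0) → Component 1 a → unitary (H →L[ℂ] H)

/-- `u` is a connection system: `u_a(b̄) = u_a(b)*`, and `u_a` is trivial on trivial loops. -/
def IsConnectionSystem (u : Family H) : Prop :=
  (∀ (a : Simplex 0) (b : Component 1 a), u a b.opp = star (u a b)) ∧
  ∀ (a : Simplex 0) (a' : Component 0 a), u a ⟨trivialLoop a'.1, a'.2⟩ = 1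

/-- The extension `u_a(b_n ⋯ b_1) = u_a(b_n) ⋯ u_a(b_1)` to words in `Σ_1^a`. -/
def onWord (u : Family H) (a : Simplex 0) (p : List (Component 1 a)) : unitary (H →L[ℂ] H) :=
  (p.map (u a)).prod

/-- `p` is a loop over `a` that belongs to the group `L_o` of loops supported in `o`. -/
def IsLoopIn (o : Set Spacetime) (a : Simplex 0) (p : List (Component 1 a)) : Prop :=
  IsPath (p.map Subtype.val) a a ∧ wordSupport (p.map Subtype.val) ⊆ o

/-- Causality: loops supported in causally disjoint double cones have commuting values. -/
def IsCausal (u : Family H) : Prop :=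
  ∀ o ∈ doubleCones, ∀ o' ∈ doubleCones, CausallyDisjoint o o' →
    ∀ (a a' : Simplex 0) (p : List (Component 1 a)) (p' : List (Component 1 a')),
      IsLoopIn o a p → IsLoopIn o' a' p' → Commute (onWord u a p) (onWord u a' p')

/-- Covariance: `U(P) u_a(b) U(P)* = u_{Pa}(Pb)`. -/
def IsCovariant (u : Family H) (U : Poincare →* unitary (H →L[ℂ] H)) : Prop :=
  ∀ (P : Poincare) (a : Simplex 0) (b : Component 1 a),
    U P * u a b * star (U P) = u (a.move P) (b.move P)

/-- `(u, U)` is a causal and covariant connection system. -/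
structure IsCausalCovariantConnection (u : Family H) (U : Poincare →* unitary (H →L[ℂ] H)) :
    Prop where
  connection : IsConnectionSystem u
  causal : IsCausal u
  covariant : IsCovariant u U

/-- Families of maps `g_a : Σ_0^a → U(H)`. -/
abbrev GaugeFamily (H : Type*) [NormedAddCommGroup H] [InnerProductSpace ℂ H] [CompleteSpace H] :
    Type _ :=
  (a : Simplex 0) → Component 0 a → unitary (H →L[ℂ] H)

/-- The family of unitaries `t` realizes an equivalence `(u, U) ≅ (u', U')`:
`t_a(∂_0 b) u_a(b) = u'_a(b) t_a(∂_1 b)` and `t_{Pa}(Pa') U(P) = U'(P) t_a(a')`. -/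
def IsEquivalence (u : Family H) (U : Poincare →* unitary (H →L[ℂ] H))
    (u' : Family H) (U' : Poincare →* unitary (H →L[ℂ] H)) (t : GaugeFamily H) : Prop :=
  (∀ (a : Simplex 0) (b : Component 1 a),
    t a (b.face 0) * u a b = u' a b * t a (b.face 1)) ∧
  ∀ (P : Poincare) (a : Simplex 0) (a' : Component 0 a),
    t (a.move P) (a'.move P) * U P = U' P * t a a'

/-- The local algebra of `u` in `o`, i.e. the image of the C*-algebra generated by the loops
supported in `o` under the representation defined by `u`: the norm closed *-algebra generated by
the operators `u_a(p)`, where `p` is a loop over some `a` which is supported in `o`. -/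
def localAlgebra (u : Family H) (o : Set Spacetime) : StarSubalgebra ℂ (H →L[ℂ] H) :=
  (StarAlgebra.adjoin ℂ {T : H →L[ℂ] H | ∃ (a : Simplex 0) (p : List (Component 1 a)),
    IsLoopIn o a p ∧ T = onWord u a p}).topologicalClosure

/-- `g` is a gauge transformation of `(u, U)`: it is covariant, `U(P) g_a(a') U(P)* = g_{Pa}(Pa')`,
and `g_a(a)` leaves the local algebras of the double cones containing `a` invariant. -/
def IsGaugeTransformation (u : Family H) (U : Poincare →* unitary (H →L[ℂ] H))
    (g : GaugeFamily H) : Prop :=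
  (∀ (P : Poincare) (a : Simplex 0) (a' : Component 0 a),
    U P * g a a' * star (U P) = g (a.move P) (a'.move P)) ∧
  ∀ a : Simplex 0, ∀ o ∈ doubleCones, supp₀ a ⊆ o →
    (fun T : H →L[ℂ] H => (g a (Component.base a) : H →L[ℂ] H) * T *
      star (g a (Component.base a) : H →L[ℂ] H)) '' (localAlgebra u o : Set (H →L[ℂ] H)) =
      (localAlgebra u o : Set (H →L[ℂ] H))

/-- The gauge transform `u^g_a(b) = g_a(∂_0 b) u_a(b) g_a(∂_1 b)*`. -/
def gaugeTransform (g : GaugeFamily H) (u : Family H) : Family H :=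
  fun a b => g a (b.face 0) * u a b * star (g a (b.face 1))

namespace QuantumEMField

/-- The loop `p_{(a, ∂_0 b)} b p̄_{(a, ∂_1 b)}` over the pole `a`. -/
def frameLoop (Γ : PathFrameSystem) (a : Simplex 0) (b : Component 1 a) : Loop a :=
  ⟨Γ.path a (b.face 0) ++ ([b.1] ++ Word.opp (Γ.path a (b.face 1))),
    ((Γ.isPath a (b.face 1)).opp.append (IsPath.single b.1)).append (Γ.isPath a (b.face 0))⟩

/-- The family `u^em_Γ`, `u_a(b) = λ^em(p_{(a, ∂_0 b)} b p̄_{(a, ∂_1 b)})`. -/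
def uEm (𝔽 : QuantumEMField H) (Γ : PathFrameSystem) : Family H :=
  fun a b => 𝔽.lambdaEm (frameLoop Γ a b)

/-- The family `u^pot`, `u_a(b) = exp (i A^{a_0}⟨r_b, f⟩)`. -/
def uPot (𝔽 : QuantumEMField H) : Family H :=
  fun a b => expI (𝔽.lineIntegral (a.vtx 0) b.1).closure

/-- The family `g_a(a') = λ^em(p_{(a, a')} ē_{(a, a')})`. -/
def gEm (𝔽 : QuantumEMField H) (Γ : PathFrameSystem) : GaugeFamily H :=
  fun a a' => 𝔽.lambdaEm
    (⟨Γ.path a a' ++ Word.opp (euclidean.path a a'),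
      (euclidean.isPath a a').opp.append (Γ.isPath a a')⟩ : Loop a)

end QuantumEMField

end Connections

end

end EMLoops

open EMLoops

/-! Everything is read off from the cone products `coneProd`, W_a(b_n ⋯ b_1) = w^em(h^a(b_n)) ⋯
w^em(h^a(b_1)), defined for all words and not only for loops. W_a is multiplicative, turns opposites
into adjoints (exchanging two vertices reverses the surface element) and is 1 on degenerate letters,
so it depends only on the reduced word (`coneProd_reduce`). Hence u_a(b) = W_a(p_{(a,∂₀b)})
w^em(h^a(b)) W_a(p_{(a,∂₁b)})*. For the Euclidean frame the cone over a segment ending at the pole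
is flat, W_a is 1 on it, and u_a(b) is just w^em(h^a(b)). Consequently g_a(a') = W_a(p_{(a,a')}),
and the intertwining relation is a cancellation. Moreover g_a(a) = 1, because p_{(a,a)} is
degenerate, so that conjugation by it fixes every local algebra.

Causality: the frame paths telescope, so a loop over a has the value W_a(p) (`onWord_uEm`), which
may be computed from its reduced word. The support of a nondegenerate 1-simplex controls only
averages of the smearing function f along an edge; a decay argument shows that it still traps f
translated to each end point between points of the support (`vtx_add_mem_convexJoin`). Double cones
are bounded and convex, and the pole is a vertex of the reduced loop, so each cone over a reduced
letter is localized in the given double cone (`cone_vtx_add_mem`). Strong causality then makes all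
factors of the two loops commute.

Equality with the potential: the square with coordinates (s,t) parametrizes the cone by z + t(r(s) -
z), with Jacobian t. The antisymmetric part of the line tensor is therefore that of half the surface
form (`lineTensor_sub_lineTensor`), and the antisymmetric field sees nothing else.

The analysis behind this concerns exponentials of closures. Stone's theorem is obtained from bounded
functions of the resolvents. By essential self-adjointness an exponential is identified by any
unitary group having the right derivative on the common domain (`expField_eq`). Covariance, inverses
and the passage of causality from components to contractions (`commute_expField`) all rest on this
criterion. -/

namespace EMLoops
noncomputable section

/-! ### Resolvents and bounded approximants of self-adjoint operators. -/

section Resolvents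

variable {H : Type*} [NormedAddCommGroup H] [InnerProductSpace ℂ H] [CompleteSpace H]

theorem _root_.IsSelfAdjoint.mem_graph_iff {A : H →ₗ.[ℂ] H} (hA : IsSelfAdjoint A) {ψ φ : H} :
    (ψ, φ) ∈ A.graph ↔ ∀ a b, (a, b) ∈ A.graph → inner ℂ b ψ = inner ℂ a φ := by
  conv_lhs => rw [← LinearPMap.isSelfAdjoint_def.1 hA,
    LinearPMap.adjoint_graph_eq_graph_adjoint hA.dense_domain]
  simp only [Submodule.mem_adjoint_iff, sub_eq_zero]

theorem _root_.IsSelfAdjoint.inner_graph {A : H →ₗ.[ℂ] H} (hA : IsSelfAdjoint A) {ψ φ a b : H}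
    (h : (ψ, φ) ∈ A.graph) (h' : (a, b) ∈ A.graph) : inner ℂ b ψ = inner ℂ a φ :=
  hA.mem_graph_iff.1 h a b h'

/-- Symmetry makes ⟨φ, ψ⟩ real, so the cross term with an imaginary multiple of ψ has no real part.
All the resolvent bounds come from this identity. -/
theorem _root_.IsSelfAdjoint.norm_add_smul_sq {A : H →ₗ.[ℂ] H} (hA : IsSelfAdjoint A) {ψ φ : H}
    (h : (ψ, φ) ∈ A.graph) (c : ℝ) :
    ‖φ + ((c : ℂ) * Complex.I) • ψ‖ ^ 2 = ‖φ‖ ^ 2 + c ^ 2 * ‖ψ‖ ^ 2 := by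
  have hs := hA.inner_graph h h
  have him : (inner ℂ φ ψ : ℂ).im = 0 := by
    have := congrArg Complex.im (inner_conj_symm (𝕜 := ℂ) ψ φ)
    rw [← hs, Complex.conj_im] at this
    linarith
  rw [@norm_add_sq ℂ, inner_smul_right, norm_smul]
  simp [mul_pow, him]

/-- The resolvents of a self-adjoint operator at the points of the imaginary axis. -/
theorem _root_.IsSelfAdjoint.exists_resolvent {A : H →ₗ.[ℂ] H} (hA : IsSelfAdjoint A) {c : ℝ}
    (hc : c ≠ 0) : ∃ R : H →L[ℂ] H,
      (∀ η, (R η, η - ((c : ℂ) * Complex.I) • R η) ∈ A.graph) ∧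
      ∀ ψ φ, (ψ, φ) ∈ A.graph → R (φ + ((c : ℂ) * Complex.I) • ψ) = ψ := by
  set κ : ℂ := (c : ℂ) * Complex.I with hκ
  -- On the graph, which is complete because A is closed, the unbounded map A + ic becomes a bounded
  -- one.
  let e : A.graph →L[ℂ] H :=
    (ContinuousLinearMap.snd ℂ H H + κ • ContinuousLinearMap.fst ℂ H H).comp A.graph.subtypeL
  have he : ∀ x : A.graph, e x = x.1.2 + κ • x.1.1 := fun x => rfl
  have hnorm : ∀ x : A.graph, ‖e x‖ ^ 2 = ‖x.1.2‖ ^ 2 + c ^ 2 * ‖x.1.1‖ ^ 2 := fun x =>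
    hA.norm_add_smul_sq x.2 c
  have : CompleteSpace A.graph := hA.isClosed.completeSpace_coe
  have hc0 : 0 < |c| := abs_pos.2 hc
  have h1 : ∀ x : A.graph, |c| * ‖x.1.1‖ ≤ ‖e x‖ := fun x => by
    refine le_of_sq_le_sq ?_ (norm_nonneg _)
    rw [hnorm, mul_pow, sq_abs]
    nlinarith [sq_nonneg ‖x.1.2‖]
  have h2 : ∀ x : A.graph, ‖x.1.2‖ ≤ ‖e x‖ := fun x => by
    refine le_of_sq_le_sq ?_ (norm_nonneg _)
    rw [hnorm]
    nlinarith [mul_nonneg (sq_nonneg c) (sq_nonneg ‖x.1.1‖)]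
  -- The graph carries the maximum norm of the product: the constant 1 serves the second component
  -- and 1/|c| the first.
  have hanti : AntilipschitzWith (Real.toNNReal (max 1 |c|⁻¹)) e := by
    refine AddMonoidHomClass.antilipschitz_of_bound e fun x => ?_
    rw [Real.coe_toNNReal _ (by positivity)]
    change max ‖x.1.1‖ ‖x.1.2‖ ≤ _
    refine max_le ?_ ?_
    · have : ‖x.1.1‖ ≤ |c|⁻¹ * ‖e x‖ := by
        rw [← div_eq_inv_mul, le_div_iff₀ hc0, mul_comm]; exact h1 x
      exact this.trans (by gcongr; exact le_max_right _ _)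
    · calc ‖x.1.2‖ ≤ 1 * ‖e x‖ := by rw [one_mul]; exact h2 x
        _ ≤ _ := by gcongr; exact le_max_left _ _
  have hclosed : IsClosed (LinearMap.range (e : A.graph →ₗ[ℂ] H) : Set H) := by
    rw [LinearMap.coe_range]
    exact hanti.isClosed_range e.uniformContinuous
  have : CompleteSpace (LinearMap.range (e : A.graph →ₗ[ℂ] H)) := hclosed.completeSpace_coe
  have hrange : LinearMap.range (e : A.graph →ₗ[ℂ] H) = ⊤ := by
    rw [← Submodule.orthogonal_eq_bot_iff, Submodule.eq_bot_iff]
    intro η hη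
    rw [Submodule.mem_orthogonal] at hη
    -- A vector orthogonal to the range is an eigenvector of A* = A with the imaginary eigenvalue κ;
    -- the norm identity at -c then forces it to vanish.
    have hm : (η, κ • η) ∈ A.graph := by
      rw [hA.mem_graph_iff]
      intro a b hab
      have := hη _ ⟨⟨(a, b), hab⟩, rfl⟩
      change inner ℂ (b + κ • a) η = 0 at this
      rw [inner_add_left, inner_smul_left] at this
      rw [inner_smul_right]
      have hk : (starRingEnd ℂ) κ = -κ := by simp [hκ]
      rw [hk] at this
      linear_combination this
    have hs := hA.norm_add_smul_sq hm (-c)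
    have hz : κ • η + (((-c : ℝ) : ℂ) * Complex.I) • η = 0 := by
      rw [hκ, ← add_smul]; simp
    rw [hz, norm_zero] at hs
    have : c ^ 2 * ‖η‖ ^ 2 = 0 := by
      nlinarith [sq_nonneg ‖κ • η‖, mul_nonneg (sq_nonneg c) (sq_nonneg ‖η‖)]
    simpa [hc] using this
  have hker : LinearMap.ker (e : A.graph →ₗ[ℂ] H) = ⊥ := LinearMap.ker_eq_bot.2 hanti.injective
  let E := ContinuousLinearEquiv.ofBijective e hker hrange
  have hE : ∀ x, E x = e x := fun x => rfl
  refine ⟨(ContinuousLinearMap.fst ℂ H H).comp (A.graph.subtypeL.comp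
    (E.symm : H →L[ℂ] A.graph)), fun η => ?_, fun ψ φ h => ?_⟩
  · change ((E.symm η).1.1, η - κ • (E.symm η).1.1) ∈ A.graph
    have h3 : (E.symm η).1.2 + κ • (E.symm η).1.1 = η := by
      rw [← he, ← hE, E.apply_symm_apply]
    have h4 : η - κ • (E.symm η).1.1 = (E.symm η).1.2 := by
      rw [sub_eq_iff_eq_add, h3]
    rw [h4]
    exact (E.symm η).2
  · change (E.symm (φ + κ • ψ)).1.1 = ψ
    have h3 : E ⟨(ψ, φ), h⟩ = φ + κ • ψ := rfl
    rw [← h3, E.symm_apply_apply]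

/-- Bounded, mutually commuting, self-adjoint approximants of a self-adjoint operator. -/
theorem _root_.IsSelfAdjoint.exists_approximants {A : H →ₗ.[ℂ] H} (hA : IsSelfAdjoint A) :
    ∃ B : ℕ → selfAdjoint (H →L[ℂ] H),
      (∀ n m, Commute (B n : H →L[ℂ] H) (B m : H →L[ℂ] H)) ∧
      ∀ ψ φ, (ψ, φ) ∈ A.graph →
        Filter.Tendsto (fun n => (B n : H →L[ℂ] H) ψ) Filter.atTop (nhds φ) := by
  -- R c is the resolvent (A + ic)⁻¹; the value at c = 0 is a dummy that makes the family total.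
  have hex : ∀ c : ℝ, ∃ R : H →L[ℂ] H, c ≠ 0 →
      (∀ η, (R η, η - ((c : ℂ) * Complex.I) • R η) ∈ A.graph) ∧
      ∀ ψ φ, (ψ, φ) ∈ A.graph → R (φ + ((c : ℂ) * Complex.I) • ψ) = ψ := fun c => by
    by_cases hc : c = 0
    · exact ⟨0, fun h => absurd hc h⟩
    · obtain ⟨R, hR⟩ := hA.exists_resolvent hc
      exact ⟨R, fun _ => hR⟩
  choose R hR using hex
  have hmem : ∀ c : ℝ, c ≠ 0 → ∀ η, (R c η, η - ((c : ℂ) * Complex.I) • R c η) ∈ A.graph :=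
    fun c hc => (hR c hc).1
  have hleft : ∀ c : ℝ, c ≠ 0 → ∀ ψ φ, (ψ, φ) ∈ A.graph →
      R c (φ + ((c : ℂ) * Complex.I) • ψ) = ψ := fun c hc => (hR c hc).2
  have hbound : ∀ c : ℝ, c ≠ 0 → ∀ η, |c| * ‖R c η‖ ≤ ‖η‖ := by
    intro c hc η
    have := hA.norm_add_smul_sq (hmem c hc η) c
    rw [sub_add_cancel] at this
    refine le_of_sq_le_sq ?_ (norm_nonneg _)
    rw [this, mul_pow, sq_abs]
    nlinarith [sq_nonneg ‖η - ((c : ℂ) * Complex.I) • R c η‖]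
  have hadj : ∀ c : ℝ, c ≠ 0 → ∀ η ξ, inner ℂ (R c η) ξ = inner ℂ η (R (-c) ξ) := by
    intro c hc η ξ
    have := hA.inner_graph (hmem (-c) (neg_ne_zero.2 hc) ξ) (hmem c hc η)
    simp only [inner_sub_left, inner_sub_right, inner_smul_left, inner_smul_right, map_mul,
      Complex.conj_I, Complex.conj_ofReal, Complex.ofReal_neg] at this
    linear_combination -this
  -- The resolvent identity R_d - R_c = i(c - d) R_c R_d, obtained by applying R_c to a difference
  -- of two graph elements, shows that R_c R_d also has the property characterizing R_d R_c.
  have hcomm : ∀ c d : ℝ, c ≠ 0 → d ≠ 0 → Commute (R c) (R d) := by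
    intro c d hc hd
    ext η
    change R c (R d η) = R d (R c η)
    set y := R d η with hy
    set z := R c η with hz
    set x := R c y with hx
    have m1 := hmem d hd η
    have m2 := hmem c hc η
    have m3 := hmem c hc y
    have m4 := A.graph.sub_mem m1 m2
    rw [Prod.mk_sub_mk] at m4
    have h5 := hleft c hc _ _ m4
    have e1 : η - ((d : ℂ) * Complex.I) • R d η - (η - ((c : ℂ) * Complex.I) • R c η) +
        ((c : ℂ) * Complex.I) • (R d η - R c η) = (((c : ℂ) - d) * Complex.I) • y := by
      rw [← hy]; module
    rw [e1, map_smul, ← hx, ← hy, ← hz] at h5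
    have m6 := hleft d hd x (z - ((d : ℂ) * Complex.I) • x) (by
      convert m3 using 2
      rw [← hx]
      have : z = y - (((c : ℂ) - d) * Complex.I) • x := by rw [h5]; abel
      rw [this]; module)
    rw [sub_add_cancel] at m6
    exact m6.symm
  -- The approximant is c² A (A² + c²)⁻¹, written through resolvents. It is self-adjoint because R_c
  -- and R_{-c} are adjoint to each other.
  have hsa : ∀ c : ℝ, c ≠ 0 → IsSelfAdjoint (((c ^ 2 / 2 : ℝ) : ℂ) • (R c + R (-c))) := by
    intro c hc
    rw [ContinuousLinearMap.isSelfAdjoint_iff_isSymmetric]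
    intro η ξ
    have h1 := hadj c hc η ξ
    have h2 := hadj (-c) (neg_ne_zero.2 hc) η ξ
    rw [neg_neg] at h2
    change inner ℂ (((c ^ 2 / 2 : ℝ) : ℂ) • (R c η + R (-c) η)) ξ =
      inner ℂ η (((c ^ 2 / 2 : ℝ) : ℂ) • (R c ξ + R (-c) ξ))
    rw [inner_smul_left, inner_smul_right, inner_add_left, inner_add_right, h1, h2,
      Complex.conj_ofReal]
    ring
  have hpos : ∀ n : ℕ, ((n : ℝ) + 1) ≠ 0 := fun n => by positivity
  refine ⟨fun n => ⟨_, hsa (n + 1) (hpos n)⟩, fun n m => ?_, ?_⟩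
  · have h : ∀ c d : ℝ, c ≠ 0 → d ≠ 0 → Commute (R c + R (-c)) (R d + R (-d)) := fun c d hc hd =>
      ((hcomm c d hc hd).add_left (hcomm _ _ (neg_ne_zero.2 hc) hd)).add_right
        ((hcomm c _ hc (neg_ne_zero.2 hd)).add_left
          (hcomm _ _ (neg_ne_zero.2 hc) (neg_ne_zero.2 hd)))
    exact ((h _ _ (hpos n) (hpos m)).smul_left _).smul_right _
  -- M c is c² (A² + c²)⁻¹. The approximant applied to ψ is M c (Aψ), and M c tends strongly to 1:
  -- it is a contraction, and on the domain ‖M c φ - φ‖ ≤ ‖Aφ‖ / |c|.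
  · let M : ℝ → H → H := fun c φ => (1 / 2 : ℂ) •
      (((c : ℂ) * Complex.I) • R c φ - ((c : ℂ) * Complex.I) • R (-c) φ)
    have hM : ∀ c : ℝ, c ≠ 0 → ∀ ψ φ, (ψ, φ) ∈ A.graph →
        (((c ^ 2 / 2 : ℝ) : ℂ) • (R c + R (-c))) ψ = M c φ := by
      intro c hc ψ φ h
      have h1 := hleft c hc _ _ h
      have h2 := hleft (-c) (neg_ne_zero.2 hc) _ _ h
      rw [map_add, map_smul] at h1 h2
      rw [Complex.ofReal_neg] at h2
      have h3 : R c φ = ψ - ((c : ℂ) * Complex.I) • R c ψ := eq_sub_of_add_eq h1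
      have h4 : R (-c) φ = ψ - (-(c : ℂ) * Complex.I) • R (-c) ψ := eq_sub_of_add_eq h2
      change ((c ^ 2 / 2 : ℝ) : ℂ) • (R c ψ + R (-c) ψ) = (1 / 2 : ℂ) •
        (((c : ℂ) * Complex.I) • R c φ - ((c : ℂ) * Complex.I) • R (-c) φ)
      rw [h3, h4]
      push_cast
      match_scalars
      all_goals first
        | linear_combination ((c : ℂ) ^ 2 / 2) * Complex.I_sq
        | linear_combination (-(c : ℂ) ^ 2 / 2) * Complex.I_sq
        | ring
    have hMsub : ∀ (c : ℝ), c ≠ 0 → ∀ φ χ : H, ‖M c φ - M c χ‖ ≤ ‖φ - χ‖ := by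
      intro c hc φ χ
      have e : M c φ - M c χ = (1 / 2 : ℂ) • (((c : ℂ) * Complex.I) • R c (φ - χ) -
          ((c : ℂ) * Complex.I) • R (-c) (φ - χ)) := by
        simp only [M, map_sub]; module
      have b1 := hbound c hc (φ - χ)
      have b2 := hbound (-c) (neg_ne_zero.2 hc) (φ - χ)
      rw [abs_neg] at b2
      rw [e, norm_smul]
      have := norm_sub_le (((c : ℂ) * Complex.I) • R c (φ - χ))
        (((c : ℂ) * Complex.I) • R (-c) (φ - χ))
      simp only [norm_smul, norm_mul, Complex.norm_real, Complex.norm_I, mul_one,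
        Real.norm_eq_abs] at this
      simp only [norm_div, norm_one, Complex.norm_ofNat]
      linarith
    have hMg : ∀ c : ℝ, c ≠ 0 → ∀ φ χ, (φ, χ) ∈ A.graph → |c| * ‖M c φ - φ‖ ≤ ‖χ‖ := by
      intro c hc φ χ h
      have h1 := hleft c hc _ _ h
      have h2 := hleft (-c) (neg_ne_zero.2 hc) _ _ h
      rw [map_add, map_smul] at h1 h2
      rw [Complex.ofReal_neg] at h2
      have h3 : ((c : ℂ) * Complex.I) • R c φ = φ - R c χ := eq_sub_of_add_eq' h1
      have h4 : (-(c : ℂ) * Complex.I) • R (-c) φ = φ - R (-c) χ := eq_sub_of_add_eq' h2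
      have e : M c φ - φ = -((1 / 2 : ℂ) • (R c χ + R (-c) χ)) := by
        have : M c φ = (1 / 2 : ℂ) •
            (((c : ℂ) * Complex.I) • R c φ + (-(c : ℂ) * Complex.I) • R (-c) φ) := by
          simp only [M]; module
        rw [this, h3, h4]; module
      have b1 := hbound c hc χ
      have b2 := hbound (-c) (neg_ne_zero.2 hc) χ
      rw [abs_neg] at b2
      rw [e, norm_neg, norm_smul]
      simp only [norm_div, norm_one, Complex.norm_ofNat]
      have := mul_le_mul_of_nonneg_left (norm_add_le (R c χ) (R (-c) χ)) (abs_nonneg c)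
      nlinarith
    intro ψ φ h
    rw [Metric.tendsto_atTop]
    intro ε hε
    obtain ⟨φ', hφ', hd⟩ := Metric.dense_iff.1 hA.dense_domain φ (ε / 3) (by positivity)
    rw [Metric.mem_ball, dist_eq_norm] at hφ'
    obtain ⟨N, hN⟩ := exists_nat_gt (3 * ‖A ⟨φ', hd⟩‖ / ε)
    refine ⟨N, fun n hn => ?_⟩
    have hnc : (0 : ℝ) < (n : ℝ) + 1 := by positivity
    change dist ((((((n : ℝ) + 1) ^ 2 / 2 : ℝ) : ℂ) • (R (n + 1) + R (-(n + 1)))) ψ) φ < ε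
    rw [hM _ (hpos n) ψ φ h, dist_eq_norm]
    have k1 := hMsub _ (hpos n) φ φ'
    have k2 := hMg _ (hpos n) φ' _ (A.mem_graph ⟨φ', hd⟩)
    rw [abs_of_pos hnc] at k2
    have k3 : 3 * ‖A ⟨φ', hd⟩‖ < ε * (n + 1) := by
      rw [div_lt_iff₀ hε] at hN
      have : (N : ℝ) ≤ n := by exact_mod_cast hn
      nlinarith
    have k4 : ‖M (n + 1) φ' - φ'‖ < ε / 3 := by
      have : (n + 1 : ℝ) * ‖M (n + 1) φ' - φ'‖ < (n + 1) * (ε / 3) := by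
        refine k2.trans_lt ?_; linarith
      exact lt_of_mul_lt_mul_left this hnc.le
    calc ‖M (n + 1) φ - φ‖ = ‖(M (n + 1) φ - M (n + 1) φ') + (M (n + 1) φ' - φ') + (φ' - φ)‖ := by
          congr 1; abel
      _ ≤ ‖M (n + 1) φ - M (n + 1) φ'‖ + ‖M (n + 1) φ' - φ'‖ + ‖φ' - φ‖ := norm_add₃_le
      _ < ε := by rw [norm_sub_rev φ φ'] at k1; linarith

end Resolvents

/-! ### Stone's theorem and the identification of generators on a core. -/

section Stone

open Filter Topology

variable {H : Type*} [NormedAddCommGroup H] [InnerProductSpace ℂ H] [CompleteSpace H]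

theorem norm_unitary_apply (u : unitary (H →L[ℂ] H)) (ψ : H) : ‖(u : H →L[ℂ] H) ψ‖ = ‖ψ‖ :=
  (Unitary.linearIsometryEquiv u).norm_map ψ

theorem unitary_mul_star_apply (u : unitary (H →L[ℂ] H)) (ψ : H) :
    (u : H →L[ℂ] H) (((star u : unitary (H →L[ℂ] H)) : H →L[ℂ] H) ψ) = ψ := by
  rw [← unitary_mul_apply, Unitary.mul_star_self]; rfl

theorem inner_unitary_apply_left (u : unitary (H →L[ℂ] H)) (ψ φ : H) :
    inner ℂ ((u : H →L[ℂ] H) ψ) φ = inner ℂ ψ ((star u : H →L[ℂ] H) φ) := by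
  rw [ContinuousLinearMap.star_eq_adjoint, ContinuousLinearMap.adjoint_inner_right]

/-- `exp (i t B)` for a bounded self-adjoint `B`. -/
def expGroup (B : selfAdjoint (H →L[ℂ] H)) (t : ℝ) : unitary (H →L[ℂ] H) :=
  selfAdjoint.expUnitary ⟨t • (B : H →L[ℂ] H), (IsSelfAdjoint.all t).smul B.2⟩

theorem expGroup_coe (B : selfAdjoint (H →L[ℂ] H)) (t : ℝ) :
    (expGroup B t : H →L[ℂ] H) = NormedSpace.exp (t • (Complex.I • (B : H →L[ℂ] H))) := by
  rw [expGroup, selfAdjoint.expUnitary_coe, smul_comm]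

theorem expGroup_zero (B : selfAdjoint (H →L[ℂ] H)) : expGroup B 0 = 1 := by
  refine Subtype.ext ?_
  rw [expGroup_coe, zero_smul, NormedSpace.exp_zero]; rfl

theorem expGroup_add (B : selfAdjoint (H →L[ℂ] H)) (s t : ℝ) :
    expGroup B (s + t) = expGroup B s * expGroup B t := by
  rw [expGroup, expGroup, expGroup, ← Commute.expUnitary_add]
  · exact congrArg _ (Subtype.ext (add_smul s t (B : H →L[ℂ] H)))
  · exact ((Commute.refl (B : H →L[ℂ] H)).smul_left s).smul_right t

theorem expGroup_hasDerivAt (B : selfAdjoint (H →L[ℂ] H)) (ψ : H) (t : ℝ) :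
    HasDerivAt (fun t => (expGroup B t : H →L[ℂ] H) ψ)
      ((expGroup B t : H →L[ℂ] H) (Complex.I • (B : H →L[ℂ] H) ψ)) t := by
  have h := hasDerivAt_exp_smul_const (𝕂 := ℝ) (Complex.I • (B : H →L[ℂ] H)) t
  simp only [← expGroup_coe] at h
  exact ((ContinuousLinearMap.apply ℂ H ψ).restrictScalars ℝ).hasFDerivAt.comp_hasDerivAt t h

theorem norm_expGroup_sub_self_le (B : selfAdjoint (H →L[ℂ] H)) (ψ : H) (t : ℝ) :
    ‖(expGroup B t : H →L[ℂ] H) ψ - ψ‖ ≤ |t| * ‖(B : H →L[ℂ] H) ψ‖ := by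
  have := Convex.norm_image_sub_le_of_norm_hasDerivWithin_le (s := Set.univ) (x := 0) (y := t)
    (C := ‖(B : H →L[ℂ] H) ψ‖) (fun x _ => (expGroup_hasDerivAt B ψ x).hasDerivWithinAt)
    (fun x _ => by rw [norm_unitary_apply, norm_smul, Complex.norm_I, one_mul]) convex_univ
    trivial trivial
  rw [expGroup_zero] at this
  simpa [mul_comm] using this

/-- Commuting exponentials satisfy exp(itB) = exp(itC) exp(it(B - C)), so strong convergence of the
approximants on a vector passes to their groups. -/
theorem norm_expGroup_sub_le {B C : selfAdjoint (H →L[ℂ] H)}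
    (h : Commute (B : H →L[ℂ] H) (C : H →L[ℂ] H)) (ψ : H) (t : ℝ) :
    ‖(expGroup B t : H →L[ℂ] H) ψ - (expGroup C t : H →L[ℂ] H) ψ‖ ≤
      |t| * ‖(B : H →L[ℂ] H) ψ - (C : H →L[ℂ] H) ψ‖ := by
  have e : expGroup B t = expGroup C t * expGroup (B - C) t := by
    rw [expGroup, expGroup, expGroup, ← Commute.expUnitary_add]
    · refine congrArg _ (Subtype.ext ?_)
      change t • (B : H →L[ℂ] H) = t • (C : H →L[ℂ] H) + t • ((B : H →L[ℂ] H) - C)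
      rw [← smul_add, add_sub_cancel]
    · exact ((h.symm.sub_right (Commute.refl (C : H →L[ℂ] H))).smul_left t).smul_right t
  rw [e, unitary_mul_apply, ← map_sub, norm_unitary_apply]
  exact norm_expGroup_sub_self_le (B - C) ψ t

/-- Trades η for a vector χ whose displacement is under control, at the cost of twice their
distance. -/
theorem norm_unitary_sub_self_le (u : unitary (H →L[ℂ] H)) (η χ : H) :
    ‖(u : H →L[ℂ] H) η - η‖ ≤ 2 * ‖η - χ‖ + ‖(u : H →L[ℂ] H) χ - χ‖ := by
  have e : (u : H →L[ℂ] H) η - η =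
      (u : H →L[ℂ] H) (η - χ) + ((u : H →L[ℂ] H) χ - χ) + (χ - η) := by
    rw [map_sub]; abel
  have := norm_add₃_le (a := (u : H →L[ℂ] H) (η - χ)) (b := (u : H →L[ℂ] H) χ - χ) (c := χ - η)
  rw [e]
  rw [norm_unitary_apply, norm_sub_rev χ η] at this
  linarith

/-- A first-order remainder that involves B only through Bψ and Bχ, hence survives the strong limit.
The auxiliary χ is needed because Bψ itself may tend to a vector outside the domain of the limiting
generator. -/
theorem norm_expGroup_sub_sub_le (B : selfAdjoint (H →L[ℂ] H)) (ψ χ : H) (t : ℝ) :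
    ‖(expGroup B t : H →L[ℂ] H) ψ - ψ - t • Complex.I • (B : H →L[ℂ] H) ψ‖ ≤
      |t| * (2 * ‖(B : H →L[ℂ] H) ψ - χ‖ + |t| * ‖(B : H →L[ℂ] H) χ‖) := by
  set φ := (B : H →L[ℂ] H) ψ with hφ
  have := Convex.norm_image_sub_le_of_norm_hasDerivWithin_le (s := Set.uIcc 0 t) (x := 0) (y := t)
    (f := fun s : ℝ => (expGroup B s : H →L[ℂ] H) ψ - s • Complex.I • φ)
    (C := 2 * ‖φ - χ‖ + |t| * ‖(B : H →L[ℂ] H) χ‖)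
    (fun x _ => ((expGroup_hasDerivAt B ψ x).sub
      ((hasDerivAt_id x).smul_const (Complex.I • φ))).hasDerivWithinAt)
    (fun x hx => ?_) (convex_uIcc 0 t) Set.left_mem_uIcc Set.right_mem_uIcc
  · rw [expGroup_zero] at this
    simp only [zero_smul, sub_zero, Real.norm_eq_abs] at this
    rw [sub_right_comm, mul_comm]
    exact this
  · rw [one_smul, map_smul, ← smul_sub, norm_smul, Complex.norm_I, one_mul]
    refine (norm_unitary_sub_self_le _ φ χ).trans ?_
    gcongr
    refine (norm_expGroup_sub_self_le B χ x).trans ?_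
    refine mul_le_mul_of_nonneg_right ?_ (norm_nonneg _)
    simpa using Set.abs_sub_left_of_mem_uIcc hx

/-- The strong limit of the unitary groups generated by commuting bounded self-adjoint operators
which converge strongly on a dense set. -/
theorem exists_unitaryGroup_of_approximants {B : ℕ → selfAdjoint (H →L[ℂ] H)}
    (hB : ∀ n m, Commute (B n : H →L[ℂ] H) (B m : H →L[ℂ] H))
    (hd : Dense {ψ : H | ∃ φ, Tendsto (fun n => (B n : H →L[ℂ] H) ψ) atTop (𝓝 φ)}) :
    ∃ V : ℝ → unitary (H →L[ℂ] H), IsUnitaryGroup V ∧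
      ∀ ψ φ, Tendsto (fun n => (B n : H →L[ℂ] H) ψ) atTop (𝓝 φ) →
        HasDerivAt (fun t : ℝ => (V t : H →L[ℂ] H) ψ) (Complex.I • φ) 0 := by
  have happrox : ∀ (η : H) (ε : ℝ), 0 < ε → ∃ χ χ', ‖η - χ‖ < ε ∧
      Tendsto (fun n => (B n : H →L[ℂ] H) χ) atTop (𝓝 χ') := by
    intro η ε hε
    obtain ⟨χ, h1, χ', h2⟩ := Metric.dense_iff.1 hd η ε hε
    exact ⟨χ, χ', by rwa [Metric.mem_ball', dist_eq_norm] at h1, h2⟩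
  have hcauchy : ∀ (t : ℝ) (ψ : H), CauchySeq fun n => (expGroup (B n) t : H →L[ℂ] H) ψ := by
    intro t ψ
    rw [Metric.cauchySeq_iff]
    intro ε hε
    obtain ⟨χ, χ', h1, h2⟩ := happrox ψ (ε / 4) (by positivity)
    obtain ⟨N, hN⟩ := Metric.cauchySeq_iff.1 h2.cauchySeq (ε / (2 * (|t| + 1))) (by positivity)
    refine ⟨N, fun m hm n hn => ?_⟩
    have h3 := norm_expGroup_sub_le (hB m n) χ t
    have h4 := hN m hm n hn
    rw [dist_eq_norm] at h4 ⊢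
    have h5 : |t| * ‖(B m : H →L[ℂ] H) χ - (B n : H →L[ℂ] H) χ‖ ≤ ε / 2 := by
      have : |t| * ‖(B m : H →L[ℂ] H) χ - (B n : H →L[ℂ] H) χ‖ ≤
          (|t| + 1) * (ε / (2 * (|t| + 1))) := by gcongr; linarith
      refine this.trans_eq ?_
      have := abs_nonneg t
      field_simp
    have e : (expGroup (B m) t : H →L[ℂ] H) ψ - (expGroup (B n) t : H →L[ℂ] H) ψ =
        (expGroup (B m) t : H →L[ℂ] H) (ψ - χ) +
        ((expGroup (B m) t : H →L[ℂ] H) χ - (expGroup (B n) t : H →L[ℂ] H) χ) -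
        (expGroup (B n) t : H →L[ℂ] H) (ψ - χ) := by simp only [map_sub]; abel
    rw [e]
    refine (norm_sub_le _ _).trans_lt ?_
    refine (add_le_add_left (norm_add_le _ _) _).trans_lt ?_
    rw [norm_unitary_apply, norm_unitary_apply]
    linarith
  choose W hW using fun t ψ => cauchySeq_tendsto_of_complete (hcauchy t ψ)
  let V₀ : ℝ → H →L[ℂ] H := fun t =>
    continuousLinearMapOfTendsto (fun n => (expGroup (B n) t : H →L[ℂ] H)) (tendsto_pi_nhds.2 (hW t))
  have hV₀ : ∀ t ψ, Tendsto (fun n => (expGroup (B n) t : H →L[ℂ] H) ψ) atTop (𝓝 (V₀ t ψ)) := hW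
  have hnorm : ∀ t ψ, ‖V₀ t ψ‖ = ‖ψ‖ := fun t ψ =>
    tendsto_nhds_unique ((hV₀ t ψ).norm) (by simp only [norm_unitary_apply]; exact tendsto_const_nhds)
  have hzero : V₀ 0 = 1 := by
    ext ψ
    refine tendsto_nhds_unique (hV₀ 0 ψ) ?_
    simp only [expGroup_zero]
    exact tendsto_const_nhds
  have hadd : ∀ s t, V₀ (s + t) = V₀ s * V₀ t := by
    intro s t
    ext ψ
    refine tendsto_nhds_unique (hV₀ (s + t) ψ) ?_
    have h1 : Tendsto (fun n => (expGroup (B n) s : H →L[ℂ] H)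
        ((expGroup (B n) t : H →L[ℂ] H) ψ - V₀ t ψ)) atTop (𝓝 0) := by
      rw [tendsto_zero_iff_norm_tendsto_zero]
      simp only [norm_unitary_apply]
      rw [← tendsto_zero_iff_norm_tendsto_zero, tendsto_sub_nhds_zero_iff]
      exact hV₀ t ψ
    have h2 := h1.add (hV₀ s (V₀ t ψ))
    rw [zero_add] at h2
    refine h2.congr fun n => ?_
    rw [expGroup_add, unitary_mul_apply, map_sub, sub_add_cancel]
  have hinner : ∀ t ψ φ, inner ℂ (V₀ t ψ) (V₀ t φ) = inner ℂ ψ φ := fun t ψ φ =>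
    (LinearIsometry.mk (V₀ t : H →ₗ[ℂ] H) (hnorm t)).inner_map_map ψ φ
  have hstar : ∀ t, star (V₀ t) * V₀ t = 1 := fun t => by
    ext ψ
    refine ext_inner_left ℂ fun φ => ?_
    change inner ℂ φ (star (V₀ t) (V₀ t ψ)) = inner ℂ φ ψ
    rw [ContinuousLinearMap.star_eq_adjoint, ContinuousLinearMap.adjoint_inner_right, hinner]
  have hinv : ∀ t, V₀ t * V₀ (-t) = 1 := fun t => by rw [← hadd, add_neg_cancel, hzero]
  -- A strong limit of unitaries is only isometric a priori; surjectivity comes from the group law,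
  -- which exhibits V₀ (-t) as the inverse.
  have hstar' : ∀ t, V₀ t * star (V₀ t) = 1 := fun t => by
    have : star (V₀ t) = V₀ (-t) := by
      calc star (V₀ t) = star (V₀ t) * (V₀ t * V₀ (-t)) := by rw [hinv, mul_one]
        _ = V₀ (-t) := by rw [← mul_assoc, hstar, one_mul]
    rw [this, hinv]
  let V : ℝ → unitary (H →L[ℂ] H) := fun t => ⟨V₀ t, Unitary.mem_iff.2 ⟨hstar t, hstar' t⟩⟩
  have hVadd : ∀ s t, V (s + t) = V s * V t := fun s t => Subtype.ext (hadd s t)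
  have hest : ∀ χ χ', Tendsto (fun n => (B n : H →L[ℂ] H) χ) atTop (𝓝 χ') → ∀ t : ℝ,
      ‖(V t : H →L[ℂ] H) χ - χ‖ ≤ |t| * ‖χ'‖ := fun χ χ' h t =>
    le_of_tendsto_of_tendsto' ((hV₀ t χ).sub_const χ).norm (h.norm.const_mul |t|)
      fun n => norm_expGroup_sub_self_le (B n) χ t
  refine ⟨V, ⟨Subtype.ext hzero, hVadd, fun ψ => ?_⟩, fun ψ φ h => ?_⟩
  · rw [Metric.continuous_iff]
    intro s ε hε
    obtain ⟨χ, χ', h1, h2⟩ := happrox ψ (ε / 4) (by positivity)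
    refine ⟨ε / (2 * (‖χ'‖ + 1)), by positivity, fun t ht => ?_⟩
    rw [Real.dist_eq] at ht
    have e : V t = V s * V (t - s) := by rw [← hVadd]; congr 1; ring
    rw [dist_eq_norm, e, unitary_mul_apply, ← map_sub, norm_unitary_apply]
    refine (norm_unitary_sub_self_le _ ψ χ).trans_lt ?_
    have h3 := hest χ χ' h2 (t - s)
    have h4 : |t - s| * ‖χ'‖ ≤ ε / 2 := by
      calc |t - s| * ‖χ'‖ ≤ ε / (2 * (‖χ'‖ + 1)) * (‖χ'‖ + 1) := by gcongr; linarith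
        _ = ε / 2 := by field_simp
    linarith
  · rw [hasDerivAt_iff_isLittleO_nhds_zero, Asymptotics.isLittleO_iff]
    intro ε hε
    obtain ⟨χ, χ', h1, h2⟩ := happrox φ (ε / 4) (by positivity)
    have hest2 : ∀ t : ℝ, ‖(V t : H →L[ℂ] H) ψ - ψ - t • Complex.I • φ‖ ≤
        |t| * (2 * ‖φ - χ‖ + |t| * ‖χ'‖) := fun t =>
      le_of_tendsto_of_tendsto'
        (((hV₀ t ψ).sub_const ψ).sub ((h.const_smul Complex.I).const_smul t)).norm
        ((((h.sub_const χ).norm.const_mul 2).add (h2.norm.const_mul |t|)).const_mul |t|)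
        fun n => norm_expGroup_sub_sub_le (B n) ψ χ t
    filter_upwards [Metric.ball_mem_nhds (0 : ℝ)
      (show 0 < ε / (2 * (‖χ'‖ + 1)) by positivity)] with t ht
    rw [mem_ball_zero_iff, Real.norm_eq_abs] at ht
    have hV0 : V 0 = 1 := Subtype.ext hzero
    simp only [zero_add, hV0]
    refine (hest2 t).trans ?_
    rw [Real.norm_eq_abs, mul_comm]
    gcongr
    have h4 : |t| * ‖χ'‖ ≤ ε / 2 := by
      calc |t| * ‖χ'‖ ≤ ε / (2 * (‖χ'‖ + 1)) * (‖χ'‖ + 1) := by gcongr; linarith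
        _ = ε / 2 := by field_simp
    linarith

/-- For a unitary group, the derivative at `0` on a vector determines the derivative everywhere. -/
theorem IsUnitaryGroup.hasDerivAt {V : ℝ → unitary (H →L[ℂ] H)} (hV : IsUnitaryGroup V) {ψ φ : H}
    (h : HasDerivAt (fun t : ℝ => (V t : H →L[ℂ] H) ψ) φ 0) (t : ℝ) :
    HasDerivAt (fun t : ℝ => (V t : H →L[ℂ] H) ψ) ((V t : H →L[ℂ] H) φ) t := by
  have h1 : HasDerivAt (fun s : ℝ => (V (s - t) : H →L[ℂ] H) ψ) φ t :=
    HasDerivAt.comp_sub_const t t (by rwa [sub_self])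
  have h2 := ((V t : H →L[ℂ] H).restrictScalars ℝ).hasFDerivAt.comp_hasDerivAt t h1
  refine h2.congr_of_eventuallyEq (Eventually.of_forall fun s => ?_)
  change (V s : H →L[ℂ] H) ψ = (V t : H →L[ℂ] H) ((V (s - t) : H →L[ℂ] H) ψ)
  rw [← unitary_mul_apply, ← hV.add]
  congr 3; ring

theorem IsUnitaryGroup.star_eq {V : ℝ → unitary (H →L[ℂ] H)} (hV : IsUnitaryGroup V) (t : ℝ) :
    star (V t) = V (-t) := by
  calc star (V t) = star (V t) * (V t * V (-t)) := by
        rw [← hV.add, add_neg_cancel, hV.zero, mul_one]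
    _ = V (-t) := by rw [← mul_assoc, Unitary.star_mul_self, one_mul]

/-- The generator of a unitary group is symmetric. -/
theorem IsUnitaryGroup.inner_eq {V : ℝ → unitary (H →L[ℂ] H)} (hV : IsUnitaryGroup V)
    {ψ φ a b : H} (h : HasDerivAt (fun t : ℝ => (V t : H →L[ℂ] H) ψ) (Complex.I • φ) 0)
    (h' : HasDerivAt (fun t : ℝ => (V t : H →L[ℂ] H) a) (Complex.I • b) 0) :
    inner ℂ b ψ = inner ℂ a φ := by
  have h1 : HasDerivAt (fun t : ℝ => inner ℂ a ((V t : H →L[ℂ] H) ψ)) (inner ℂ a (Complex.I • φ)) 0 := by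
    simpa only [inner_zero_left, add_zero] using (hasDerivAt_const (0 : ℝ) a).inner ℂ h
  have h2 : HasDerivAt (fun t : ℝ => (V (-t) : H →L[ℂ] H) a) (-(Complex.I • b)) 0 := by
    have := HasDerivAt.scomp (0 : ℝ) (h := fun t : ℝ => -t) (h' := -1) (by simpa using h')
      (hasDerivAt_neg (0 : ℝ))
    rw [neg_one_smul] at this
    exact this
  have h3 : HasDerivAt (fun t : ℝ => inner ℂ ((V (-t) : H →L[ℂ] H) a) ψ)
      (inner ℂ (-(Complex.I • b)) ψ) 0 := by
    simpa only [inner_zero_right, zero_add] using h2.inner ℂ (hasDerivAt_const (0 : ℝ) ψ)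
  -- Symmetry is the equality of the derivatives at 0 of the two sides of ⟨a, V_t ψ⟩ = ⟨V_{-t} a,
  -- ψ⟩.
  have h4 : (fun t : ℝ => inner ℂ a ((V t : H →L[ℂ] H) ψ)) =
      fun t : ℝ => inner ℂ ((V (-t) : H →L[ℂ] H) a) ψ := by
    funext t
    rw [inner_unitary_apply_left, ← Unitary.coe_star, hV.star_eq, neg_neg]
  rw [h4] at h1
  have h5 := h1.unique h3
  rw [inner_smul_right, inner_neg_left, inner_smul_left, Complex.conj_I] at h5
  have h6 : Complex.I * inner ℂ a φ = Complex.I * inner ℂ b ψ := by linear_combination h5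
  exact (mul_left_cancel₀ Complex.I_ne_zero h6).symm

/-- The generator of a unitary group is closed. -/
theorem IsUnitaryGroup.hasDerivAt_of_mem_closure {V : ℝ → unitary (H →L[ℂ] H)}
    (hV : IsUnitaryGroup V) {G : Set (H × H)}
    (hG : ∀ p ∈ G, HasDerivAt (fun t : ℝ => (V t : H →L[ℂ] H) p.1) (Complex.I • p.2) 0)
    {ψ φ : H} (h : (ψ, φ) ∈ closure G) :
    HasDerivAt (fun t : ℝ => (V t : H →L[ℂ] H) ψ) (Complex.I • φ) 0 := by
  rw [hasDerivAt_iff_isLittleO_nhds_zero, Asymptotics.isLittleO_iff]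
  intro ε hε
  have hc := (hV.cont φ).tendsto 0
  rw [hV.zero] at hc
  have hc' := Metric.tendsto_nhds_nhds.1 hc (ε / 2) (by positivity)
  obtain ⟨δ, hδ, hc'⟩ := hc'
  filter_upwards [Metric.ball_mem_nhds (0 : ℝ) hδ] with t ht
  rw [mem_ball_zero_iff, Real.norm_eq_abs] at ht
  simp only [zero_add, hV.zero]
  -- A remainder estimate with the same δ for all of G, using only continuity of V at φ. It is a
  -- closed condition on p, so it passes to the closure point (ψ, φ), where the first term vanishes.
  have hest : ∀ p ∈ G, ‖(V t : H →L[ℂ] H) p.1 - p.1 - t • Complex.I • p.2‖ ≤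
      |t| * (2 * ‖p.2 - φ‖ + ε / 2) := by
    rintro ⟨a, b⟩ hab
    have := Convex.norm_image_sub_le_of_norm_hasDerivWithin_le (s := Set.uIcc 0 t) (x := 0) (y := t)
      (f := fun s : ℝ => (V s : H →L[ℂ] H) a - s • Complex.I • b)
      (C := 2 * ‖b - φ‖ + ε / 2)
      (fun x _ => ((hV.hasDerivAt (hG _ hab) x).sub
        ((hasDerivAt_id x).smul_const (Complex.I • b))).hasDerivWithinAt)
      (fun x hx => ?_) (convex_uIcc 0 t) Set.left_mem_uIcc Set.right_mem_uIcc
    · rw [hV.zero] at this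
      simp only [zero_smul, sub_zero, Real.norm_eq_abs] at this
      rw [sub_right_comm, mul_comm]
      exact this
    · rw [one_smul, map_smul, ← smul_sub, norm_smul, Complex.norm_I, one_mul]
      refine (norm_unitary_sub_self_le _ b φ).trans ?_
      gcongr
      have hx' := Set.abs_sub_left_of_mem_uIcc hx
      have := hc' (x := x) (by rw [Real.dist_eq]; exact hx'.trans_lt (by simpa using ht))
      rw [dist_eq_norm] at this
      exact this.le
  have hcl : IsClosed {p : H × H | ‖(V t : H →L[ℂ] H) p.1 - p.1 - t • Complex.I • p.2‖ ≤
      |t| * (2 * ‖p.2 - φ‖ + ε / 2)} := isClosed_le (by fun_prop) (by fun_prop)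
  have h0 : ‖(V t : H →L[ℂ] H) ψ - ψ - t • Complex.I • φ‖ ≤ |t| * (2 * ‖φ - φ‖ + ε / 2) :=
    closure_minimal hest hcl h
  rw [sub_self, norm_zero, mul_zero, zero_add] at h0
  rw [Real.norm_eq_abs]
  refine h0.trans ?_
  rw [mul_comm]
  gcongr
  linarith

/-- If a unitary group is differentiable on the graph of an essentially self-adjoint operator, then
it is generated by its closure. -/
theorem EssentiallySelfAdjoint.isGenerator_closure {A : H →ₗ.[ℂ] H}
    (hA : EssentiallySelfAdjoint A) {V : ℝ → unitary (H →L[ℂ] H)} (hV : IsUnitaryGroup V)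
    (h : ∀ ψ φ, (ψ, φ) ∈ A.graph →
      HasDerivAt (fun t : ℝ => (V t : H →L[ℂ] H) ψ) (Complex.I • φ) 0) :
    IsGenerator V A.closure := by
  have hmem : ∀ ψ φ, (ψ, φ) ∈ A.closure.graph →
      HasDerivAt (fun t : ℝ => (V t : H →L[ℂ] H) ψ) (Complex.I • φ) 0 := by
    intro ψ φ hm
    rw [← hA.2.1.graph_closure_eq_closure_graph] at hm
    exact hV.hasDerivAt_of_mem_closure (G := A.graph) (fun p hp => h p.1 p.2 hp) hm
  refine fun ψ φ => ⟨hmem ψ φ, fun hd => ?_⟩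
  -- The derivative of V at 0 defines a symmetric extension of the closure, and a self-adjoint
  -- operator has no proper one.
  rw [hA.2.2.mem_graph_iff]
  exact fun a b hab => hV.inner_eq hd (hmem a b hab)

/-- The adjoint relation is closed in (a, b), so testing it on the original domain suffices. -/
theorem EssentiallySelfAdjoint.mem_graph_closure_iff {A : H →ₗ.[ℂ] H}
    (hA : EssentiallySelfAdjoint A) {ψ φ : H} :
    (ψ, φ) ∈ A.closure.graph ↔ ∀ a b, (a, b) ∈ A.graph → inner ℂ b ψ = inner ℂ a φ := by
  rw [hA.2.2.mem_graph_iff]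
  refine ⟨fun h a b hab => h a b (LinearPMap.le_graph_of_le A.le_closure hab),
    fun h a b hab => ?_⟩
  rw [← hA.2.1.graph_closure_eq_closure_graph] at hab
  have hcl : IsClosed {p : H × H | inner ℂ p.2 ψ = inner ℂ p.1 φ} :=
    isClosed_eq (by fun_prop) (by fun_prop)
  exact closure_minimal (fun p hp => h p.1 p.2 hp) hcl hab

/-- **Stone's theorem**: the closure of an essentially self-adjoint operator generates a strongly
continuous unitary group. -/
theorem EssentiallySelfAdjoint.exists_unitaryGroup {A : H →ₗ.[ℂ] H}
    (hA : EssentiallySelfAdjoint A) :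
    ∃ V : ℝ → unitary (H →L[ℂ] H), IsUnitaryGroup V ∧ IsGenerator V A.closure := by
  obtain ⟨B, hB, hlim⟩ := hA.2.2.exists_approximants
  obtain ⟨V, hV, hder⟩ := exists_unitaryGroup_of_approximants hB
    (hA.2.2.dense_domain.mono fun ψ hψ => ⟨_, hlim _ _ (A.closure.mem_graph ⟨ψ, hψ⟩)⟩)
  exact ⟨V, hV, hA.isGenerator_closure hV fun ψ φ h =>
    hder _ _ (hlim _ _ (LinearPMap.le_graph_of_le A.le_closure h))⟩

/-- An essentially self-adjoint operator is exponentiated by any unitary group that is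
differentiable on its graph. -/
theorem EssentiallySelfAdjoint.expI_closure_eq {A : H →ₗ.[ℂ] H}
    (hA : EssentiallySelfAdjoint A) {V : ℝ → unitary (H →L[ℂ] H)} (hV : IsUnitaryGroup V)
    (h : ∀ ψ φ, (ψ, φ) ∈ A.graph →
      HasDerivAt (fun t : ℝ => (V t : H →L[ℂ] H) ψ) (Complex.I • φ) 0) :
    expI A.closure = V 1 :=
  expI_eq hA.2.2.dense_domain hV (hA.isGenerator_closure hV h)

theorem IsUnitaryGroup.comp_mul {V : ℝ → unitary (H →L[ℂ] H)} (hV : IsUnitaryGroup V) (c : ℝ) :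
    IsUnitaryGroup fun t => V (c * t) where
  zero := by rw [mul_zero, hV.zero]
  add s t := by rw [mul_add, hV.add]
  cont ψ := (hV.cont ψ).comp (by fun_prop)

theorem IsUnitaryGroup.hasDerivAt_comp_mul {V : ℝ → unitary (H →L[ℂ] H)} {ψ φ : H}
    (h : HasDerivAt (fun t : ℝ => (V t : H →L[ℂ] H) ψ) (Complex.I • φ) 0) (c : ℝ) :
    HasDerivAt (fun t : ℝ => (V (c * t) : H →L[ℂ] H) ψ) (Complex.I • (c • φ)) 0 := by
  have h1 : HasDerivAt (fun t : ℝ => c * t) c 0 := by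
    simpa using (hasDerivAt_id (0 : ℝ)).const_mul c
  have := HasDerivAt.scomp (0 : ℝ) (h := fun t : ℝ => c * t) (by simpa using h) h1
  rw [smul_comm] at this
  exact this

theorem IsUnitaryGroup.conj {V : ℝ → unitary (H →L[ℂ] H)} (hV : IsUnitaryGroup V)
    (u : unitary (H →L[ℂ] H)) : IsUnitaryGroup fun t => u * V t * star u where
  zero := by rw [hV.zero, mul_one, Unitary.mul_star_self]
  add s t := by
    rw [hV.add]
    simp only [mul_assoc]
    rw [← mul_assoc (star u) u, Unitary.star_mul_self, one_mul]
  cont ψ := (u : H →L[ℂ] H).continuous.comp (hV.cont _)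

theorem IsUnitaryGroup.hasDerivAt_conj {V : ℝ → unitary (H →L[ℂ] H)} {ψ φ : H}
    (u : unitary (H →L[ℂ] H))
    (h : HasDerivAt (fun t : ℝ => (V t : H →L[ℂ] H) (((star u : unitary (H →L[ℂ] H)) : H →L[ℂ] H) ψ))
      (Complex.I • φ) 0) :
    HasDerivAt (fun t : ℝ => ((u * V t * star u : unitary (H →L[ℂ] H)) : H →L[ℂ] H) ψ)
      (Complex.I • (u : H →L[ℂ] H) φ) 0 := by
  have := ((u : H →L[ℂ] H).restrictScalars ℝ).hasFDerivAt.comp_hasDerivAt 0 h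
  simp only [ContinuousLinearMap.coe_restrictScalars', map_smul] at this
  exact this

end Stone

/-! ### Exponentials of contractions of the field. -/

namespace QuantumEMField

variable {H : Type*} [NormedAddCommGroup H] [InnerProductSpace ℂ H] [CompleteSpace H]

/-- The operator `F_{μν}(T^{μν})` on the common domain. -/
def field (𝔽 : QuantumEMField H) (T : Fin 4 → Fin 4 → 𝓢(Spacetime, ℝ)) : 𝔽.D →ₗ[ℂ] 𝔽.D :=
  ∑ μ, ∑ ν, 𝔽.F μ ν (T μ ν)

/-- The unitary `exp (i F_{μν}(T^{μν}))`. -/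
def expField (𝔽 : QuantumEMField H) (T : Fin 4 → Fin 4 → 𝓢(Spacetime, ℝ)) :
    unitary (H →L[ℂ] H) :=
  expI (contraction 𝔽.F T).closure

theorem mem_graph_contraction (𝔽 : QuantumEMField H) {T : Fin 4 → Fin 4 → 𝓢(Spacetime, ℝ)}
    {ψ φ : H} : (ψ, φ) ∈ (contraction 𝔽.F T).graph ↔
      ∃ χ : 𝔽.D, (χ : H) = ψ ∧ (𝔽.field T χ : H) = φ :=
  LinearPMap.mem_graph_iff _

/-- The working criterion for all later identities between exponentials: only derivatives at 0 on
the common domain have to be computed. -/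
theorem expField_eq (𝔽 : QuantumEMField H) {T : Fin 4 → Fin 4 → 𝓢(Spacetime, ℝ)}
    {V : ℝ → unitary (H →L[ℂ] H)} (hV : IsUnitaryGroup V)
    (h : ∀ χ : 𝔽.D, HasDerivAt (fun t : ℝ => (V t : H →L[ℂ] H) (χ : H))
      (Complex.I • (𝔽.field T χ : H)) 0) : 𝔽.expField T = V 1 := by
  refine (𝔽.essentiallySelfAdjoint T).expI_closure_eq hV fun ψ φ hm => ?_
  obtain ⟨χ, rfl, rfl⟩ := 𝔽.mem_graph_contraction.1 hm
  exact h χ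

theorem exists_group (𝔽 : QuantumEMField H) (T : Fin 4 → Fin 4 → 𝓢(Spacetime, ℝ)) :
    ∃ V : ℝ → unitary (H →L[ℂ] H), IsUnitaryGroup V ∧
      IsGenerator V (contraction 𝔽.F T).closure ∧
      (∀ χ : 𝔽.D, HasDerivAt (fun t : ℝ => (V t : H →L[ℂ] H) (χ : H))
        (Complex.I • (𝔽.field T χ : H)) 0) ∧ 𝔽.expField T = V 1 := by
  obtain ⟨V, hV, hgen⟩ := (𝔽.essentiallySelfAdjoint T).exists_unitaryGroup
  have h : ∀ χ : 𝔽.D, HasDerivAt (fun t : ℝ => (V t : H →L[ℂ] H) (χ : H))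
      (Complex.I • (𝔽.field T χ : H)) 0 := fun χ =>
    (hgen _ _).1 (LinearPMap.le_graph_of_le (LinearPMap.le_closure _)
      (𝔽.mem_graph_contraction.2 ⟨χ, rfl, rfl⟩))
  exact ⟨V, hV, hgen, h, 𝔽.expField_eq hV h⟩

theorem expField_congr (𝔽 : QuantumEMField H) {T T' : Fin 4 → Fin 4 → 𝓢(Spacetime, ℝ)}
    (h : 𝔽.field T = 𝔽.field T') : 𝔽.expField T = 𝔽.expField T' := by
  have : contraction 𝔽.F T = contraction 𝔽.F T' :=
    congrArg (fun A : 𝔽.D →ₗ[ℂ] 𝔽.D => (⟨𝔽.D, 𝔽.D.subtype ∘ₗ A⟩ : H →ₗ.[ℂ] H)) h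
  rw [expField, this, expField]

theorem expField_eq_one (𝔽 : QuantumEMField H) {T : Fin 4 → Fin 4 → 𝓢(Spacetime, ℝ)}
    (h : 𝔽.field T = 0) : 𝔽.expField T = 1 := by
  refine 𝔽.expField_eq (V := fun _ => 1) ⟨rfl, fun _ _ => (mul_one _).symm,
    fun ψ => continuous_const⟩ fun χ => ?_
  rw [h]
  simpa using hasDerivAt_const (0 : ℝ) (χ : H)

theorem field_smul (𝔽 : QuantumEMField H) (c : ℝ) (T : Fin 4 → Fin 4 → 𝓢(Spacetime, ℝ)) :
    𝔽.field (c • T) = c • 𝔽.field T := by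
  simp only [field, Pi.smul_apply, map_smul, Finset.smul_sum]

theorem expField_smul (𝔽 : QuantumEMField H) {T : Fin 4 → Fin 4 → 𝓢(Spacetime, ℝ)}
    {V : ℝ → unitary (H →L[ℂ] H)} (hV : IsUnitaryGroup V)
    (h : ∀ χ : 𝔽.D, HasDerivAt (fun t : ℝ => (V t : H →L[ℂ] H) (χ : H))
      (Complex.I • (𝔽.field T χ : H)) 0) (c : ℝ) : 𝔽.expField (c • T) = V c := by
  have := 𝔽.expField_eq (T := c • T) (hV.comp_mul c) fun χ => by
    have := IsUnitaryGroup.hasDerivAt_comp_mul (h χ) c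
    rw [field_smul]
    exact this
  rw [this, mul_one]

theorem expField_neg (𝔽 : QuantumEMField H) (T : Fin 4 → Fin 4 → 𝓢(Spacetime, ℝ)) :
    𝔽.expField (-T) = star (𝔽.expField T) := by
  obtain ⟨V, hV, -, h, hV1⟩ := 𝔽.exists_group T
  rw [hV1, hV.star_eq, ← 𝔽.expField_smul hV h, neg_one_smul]

/-- The conjugated group has the right derivative on the common domain because U(P)* = U(P⁻¹) also
preserves that domain. -/
theorem expField_conj (𝔽 : QuantumEMField H) (P : Poincare)
    {T T' : Fin 4 → Fin 4 → 𝓢(Spacetime, ℝ)}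
    (h : ∀ χ : 𝔽.D, (𝔽.U P : H →L[ℂ] H) (𝔽.field T χ : H) =
      (𝔽.field T' ⟨_, 𝔽.U_mem_D P χ⟩ : H)) :
    𝔽.U P * 𝔽.expField T * star (𝔽.U P) = 𝔽.expField T' := by
  obtain ⟨V, hV, -, hd, hV1⟩ := 𝔽.exists_group T
  rw [hV1]
  refine (𝔽.expField_eq (hV.conj (𝔽.U P)) fun χ => ?_).symm
  have hinv : star (𝔽.U P) = 𝔽.U P⁻¹ := by
    calc star (𝔽.U P) = star (𝔽.U P) * (𝔽.U P * 𝔽.U P⁻¹) := by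
          rw [← map_mul, mul_inv_cancel, map_one, mul_one]
      _ = 𝔽.U P⁻¹ := by rw [← mul_assoc, Unitary.star_mul_self, one_mul]
  set χ' : 𝔽.D := ⟨_, 𝔽.U_mem_D P⁻¹ χ⟩ with hχ'
  have hmem : ((star (𝔽.U P) : unitary (H →L[ℂ] H)) : H →L[ℂ] H) (χ : H) = (χ' : H) := by
    rw [hinv]
  have hback : (⟨_, 𝔽.U_mem_D P χ'⟩ : 𝔽.D) = χ := by
    refine Subtype.ext ?_
    change (𝔽.U P : H →L[ℂ] H) (χ' : H) = χ
    rw [← hmem, unitary_mul_star_apply]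
  have := IsUnitaryGroup.hasDerivAt_conj (V := V) (ψ := (χ : H)) (𝔽.U P) (φ := (𝔽.field T χ' : H))
    (by rw [hmem]; exact hd χ')
  rwa [h, hback] at this

/-- The tensor with the single entry `f` at `(μ, ν)`. -/
def singleTensor (μ ν : Fin 4) (f : 𝓢(Spacetime, ℝ)) : Fin 4 → Fin 4 → 𝓢(Spacetime, ℝ) :=
  fun α β => if α = μ ∧ β = ν then f else 0

theorem field_singleTensor (𝔽 : QuantumEMField H) (μ ν : Fin 4) (f : 𝓢(Spacetime, ℝ)) :
    𝔽.field (singleTensor μ ν f) = 𝔽.F μ ν f := by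
  rw [field, Finset.sum_eq_single μ, Finset.sum_eq_single ν]
  · simp [singleTensor]
  · intro β _ h; simp [singleTensor, h]
  · simp
  · intro α _ h; simp [singleTensor, h]
  · simp

theorem expI_component (𝔽 : QuantumEMField H) (μ ν : Fin 4) (f : 𝓢(Spacetime, ℝ)) :
    expI (component 𝔽.F μ ν f).closure = 𝔽.expField (singleTensor μ ν f) := by
  have : component 𝔽.F μ ν f = contraction 𝔽.F (singleTensor μ ν f) :=
    congrArg (fun A : 𝔽.D →ₗ[ℂ] 𝔽.D => (⟨𝔽.D, 𝔽.D.subtype ∘ₗ A⟩ : H →ₗ.[ℂ] H))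
      (𝔽.field_singleTensor μ ν f).symm
  rw [expField, this]

/-- A unitary which commutes with the exponentials of the components commutes with the exponential
of the contraction. -/
theorem commute_expField (𝔽 : QuantumEMField H) {T : Fin 4 → Fin 4 → 𝓢(Spacetime, ℝ)}
    {u : unitary (H →L[ℂ] H)}
    (h : ∀ (μ ν : Fin 4) (c : ℝ), Commute u (𝔽.expField (singleTensor μ ν (c • T μ ν)))) :
    Commute u (𝔽.expField T) := by
  -- Commutation is recorded in weak form: u* need not preserve the common domain, and closures of
  -- the components need not add up, but these matrix elements do.
  have hcomp : ∀ (μ ν : Fin 4) (χ χ' : 𝔽.D),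
      inner ℂ (𝔽.F μ ν (T μ ν) χ' : H) ((star u : H →L[ℂ] H) (χ : H)) =
      inner ℂ (χ' : H) ((star u : H →L[ℂ] H) (𝔽.F μ ν (T μ ν) χ : H)) := by
    intro μ ν χ χ'
    obtain ⟨V, hV, hgen, hd, -⟩ := 𝔽.exists_group (singleTensor μ ν (T μ ν))
    -- Here all multiples c in the hypothesis are needed, in order to reach the whole one-parameter
    -- group of a component.
    have hcomm : ∀ t, u * V t * star u = V t := fun t => by
      have e : t • singleTensor μ ν (T μ ν) = singleTensor μ ν (t • T μ ν) := by
        funext α β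
        simp only [Pi.smul_apply, singleTensor]
        split_ifs <;> simp
      rw [← 𝔽.expField_smul hV hd t, e, (h μ ν t).eq, mul_assoc, Unitary.mul_star_self, mul_one]
    rw [field_singleTensor] at hd
    have hcomm' : ∀ t, V t * star u = star u * V t := fun t => by
      conv_rhs => rw [← hcomm t]
      simp only [← mul_assoc]
      rw [Unitary.star_mul_self, one_mul]
    have h1 : HasDerivAt (fun t : ℝ => (V t : H →L[ℂ] H) ((star u : H →L[ℂ] H) (χ : H)))
        (Complex.I • (star u : H →L[ℂ] H) (𝔽.F μ ν (T μ ν) χ : H)) 0 := by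
      have := ((star u : H →L[ℂ] H).restrictScalars ℝ).hasFDerivAt.comp_hasDerivAt 0 (hd χ)
      simp only [ContinuousLinearMap.coe_restrictScalars', map_smul] at this
      refine this.congr_of_eventuallyEq (Filter.Eventually.of_forall fun t => ?_)
      exact congrArg (fun w : unitary (H →L[ℂ] H) => (w : H →L[ℂ] H) (χ : H)) (hcomm' t)
    exact hV.inner_eq h1 (hd χ')
  have hfield : ∀ χ χ' : 𝔽.D,
      inner ℂ (𝔽.field T χ' : H) ((star u : H →L[ℂ] H) (χ : H)) =
      inner ℂ (χ' : H) ((star u : H →L[ℂ] H) (𝔽.field T χ : H)) := by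
    intro χ χ'
    simp only [field, LinearMap.sum_apply, Submodule.coe_sum, sum_inner, map_sum, inner_sum, hcomp]
  obtain ⟨V, hV, hgen, hd, hV1⟩ := 𝔽.exists_group T
  have key := 𝔽.expField_eq (T := T) (hV.conj u) fun χ => by
    -- Essential self-adjointness of the contraction turns the summed weak relation into membership
    -- of u*χ in the domain of its closure. So u V u* is differentiable on the common domain with
    -- the same derivative as V.
    have hm : ((star u : H →L[ℂ] H) (χ : H), (star u : H →L[ℂ] H) (𝔽.field T χ : H)) ∈
        (contraction 𝔽.F T).closure.graph := by
      rw [(𝔽.essentiallySelfAdjoint T).mem_graph_closure_iff]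
      intro a b hab
      obtain ⟨χ', rfl, rfl⟩ := 𝔽.mem_graph_contraction.1 hab
      exact hfield χ χ'
    have := IsUnitaryGroup.hasDerivAt_conj (V := V) (ψ := (χ : H)) u ((hgen _ _).1 hm)
    have e : (u : H →L[ℂ] H) ((star u : H →L[ℂ] H) (𝔽.field T χ : H)) = 𝔽.field T χ :=
      unitary_mul_star_apply u _
    rwa [e] at this
  rw [Commute, SemiconjBy]
  conv_rhs => rw [key, ← hV1]
  rw [mul_assoc, Unitary.star_mul_self, mul_one]

/-- Strong causality for contractions of the field with tensors of test functions. -/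
theorem commute_expField_of_causallyDisjoint (𝔽 : QuantumEMField H)
    {S T : Fin 4 → Fin 4 → 𝓢(Spacetime, ℝ)}
    (h : ∀ μ ν α β, CausallyDisjoint (tsupport (S μ ν)) (tsupport (T α β))) :
    Commute (𝔽.expField S) (𝔽.expField T) := by
  have hsupp : ∀ (c : ℝ) (f : 𝓢(Spacetime, ℝ)), tsupport (c • f) ⊆ tsupport f := fun c f =>
    closure_mono (by
      intro x hx hfx
      exact hx (by rw [smul_apply, hfx, smul_zero]))
  -- The passage from components to contractions is made once in each of the two arguments;
  -- rescaling a test function does not enlarge its support.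
  refine 𝔽.commute_expField fun α β d => (𝔽.commute_expField fun μ ν c => ?_).symm
  rw [← expI_component, ← expI_component]
  exact (𝔽.causality μ ν α β _ _ fun x hx y hy => h μ ν α β x (hsupp c _ hx) y (hsupp d _ hy)).symm

end QuantumEMField

/-! ### Surface forms -/

theorem surfaceForm_apply (c : Simplex 2) (μ ν : Fin 4) (x : Spacetime) :
    surfaceForm c μ ν x = ((c.vtx 1 - c.vtx 0) μ * (c.vtx 2 - c.vtx 0) ν -
      (c.vtx 2 - c.vtx 0) μ * (c.vtx 1 - c.vtx 0) ν) *
        ∫ t in Δ₂, c.smear.fn (x - triangle c t) := by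
  change ∫ t in Δ₂, surfaceElement c μ ν t * c.smear.fn (x - triangle c t) = _
  simp only [surfaceElement_eq]
  exact integral_const_mul _ _

theorem lineTensor_apply (z : Spacetime) (b : Simplex 1) (μ ν : Fin 4) (x : Spacetime) :
    lineTensor z b μ ν x = ∫ r in Set.Icc (0 : ℝ) 1 ×ˢ Set.Icc (0 : ℝ) 1,
      ((line b r.1 - z) μ * r.2 * (b.vtx 1 - b.vtx 0) ν) *
        b.smear.fn (x - (z + r.2 • (line b r.1 - z))) := rfl

theorem setIntegral_standardSimplex_swap (g : ℝ × ℝ → ℝ) :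
    ∫ t in Δ₂, g t.swap = ∫ t in Δ₂, g t := by
  have h : Prod.swap ⁻¹' Δ₂ = Δ₂ := by
    ext ⟨s, t⟩
    simp only [Δ₂, Set.mem_preimage, Set.mem_ofPred_eq, Prod.swap_prod_mk, add_comm s t]
    tauto
  have := (Measure.measurePreserving_swap (μ := (volume : Measure ℝ))
    (ν := (volume : Measure ℝ))).setIntegral_preimage_emb
    MeasurableEquiv.prodComm.measurableEmbedding g Δ₂
  rwa [h] at this

theorem surfaceForm_swap {c c' : Simplex 2} (h0 : c'.vtx 0 = c.vtx 0) (h1 : c'.vtx 1 = c.vtx 2)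
    (h2 : c'.vtx 2 = c.vtx 1) (hf : c'.smear = c.smear) (μ ν : Fin 4) :
    surfaceForm c' μ ν = -surfaceForm c μ ν := by
  ext x
  have e : ∫ t in Δ₂, c'.smear.fn (x - triangle c' t) =
      ∫ t in Δ₂, c.smear.fn (x - triangle c t) := by
    rw [← setIntegral_standardSimplex_swap]
    refine integral_congr_ae (Filter.Eventually.of_forall fun t => ?_)
    have : triangle c' t.swap = triangle c t := by
      simp only [triangle, h0, h1, h2, Prod.fst_swap, Prod.snd_swap]
      rw [add_comm (t.2 • _)]
    simp only [this, hf]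
  rw [neg_apply, surfaceForm_apply, surfaceForm_apply, e, h0, h1, h2]
  ring

theorem surfaceForm_eq_zero {c : Simplex 2}
    (h : c.vtx 1 = c.vtx 0 ∨ c.vtx 2 = c.vtx 0 ∨ c.vtx 1 = c.vtx 2) (μ ν : Fin 4) :
    surfaceForm c μ ν = 0 := by
  ext x
  rw [surfaceForm_apply, zero_apply]
  rcases h with h | h | h <;> rw [h] <;> simp [mul_comm]

theorem Poincare.act_sub_act (P : Poincare) (x y : Spacetime) :
    P.act x - P.act y = P.mat *ᵥ (x - y) := by
  rw [Poincare.act, Poincare.act, Matrix.mulVec_sub, add_sub_add_left_eq_sub]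

theorem triangle_move (P : Poincare) (c : Simplex 2) (t : ℝ × ℝ) :
    triangle (c.move P) t = P.act (triangle c t) := by
  change P.act _ + (t.1 • (P.act _ - P.act _) + t.2 • (P.act _ - P.act _)) = _
  rw [Poincare.act_sub_act, Poincare.act_sub_act, triangle, Poincare.act, Poincare.act,
    Matrix.mulVec_add P.mat (c.vtx 0), Matrix.mulVec_add, Matrix.mulVec_smul, Matrix.mulVec_smul,
    add_assoc]

/-- The two edge vectors transform by L, giving the two matrix factors. No Jacobian appears, since
the integration runs over the parameters of the triangle. -/
theorem surfaceForm_move (P : Poincare) (c : Simplex 2) (α β : Fin 4) :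
    surfaceForm (c.move P) α β =
      ∑ μ, ∑ ν, (P.mat α μ * P.mat β ν) • poincareTest P (surfaceForm c μ ν) := by
  ext x
  have hsum : (∑ μ, ∑ ν, (P.mat α μ * P.mat β ν) • poincareTest P (surfaceForm c μ ν)) x =
      ∑ μ, ∑ ν, (P.mat α μ * P.mat β ν) * surfaceForm c μ ν (P⁻¹.act x) := by
    simp only [sum_apply, smul_apply, poincareTest_apply, smul_eq_mul]
  have hint : ∀ t, (c.move P).smear.fn (x - triangle (c.move P) t) =
      c.smear.fn (P⁻¹.act x - triangle c t) := by
    intro t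
    rw [triangle_move]
    change c.smear.fn (P⁻¹.mat *ᵥ (x - P.act (triangle c t))) = _
    have : triangle c t = P⁻¹.act (P.act (triangle c t)) := by
      rw [Poincare.act, Poincare.act, Matrix.mulVec_add, Matrix.mulVec_mulVec]
      have h1 : P⁻¹.mat * P.mat = 1 := congrArg Poincare.mat (inv_mul_cancel P)
      have h2 : P⁻¹.trans = -P⁻¹.mat *ᵥ P.trans := rfl
      rw [h1, h2, Matrix.one_mulVec, Matrix.neg_mulVec, neg_add_cancel_left]
    conv_rhs => rw [this, Poincare.act_sub_act]
  rw [hsum, surfaceForm_apply]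
  simp only [surfaceForm_apply, hint]
  change ((P.act _ - P.act _) α * (P.act _ - P.act _) β -
    (P.act _ - P.act _) α * (P.act _ - P.act _) β) * _ = _
  simp only [Poincare.act_sub_act]
  generalize c.vtx 1 - c.vtx 0 = v
  generalize c.vtx 2 - c.vtx 0 = w
  simp only [Matrix.mulVec, dotProduct, Finset.sum_mul]
  rw [← Finset.sum_sub_distrib, Finset.sum_mul]
  refine Finset.sum_congr rfl fun μ _ => ?_
  rw [Finset.mul_sum, Finset.mul_sum, ← Finset.sum_sub_distrib, Finset.sum_mul]
  refine Finset.sum_congr rfl fun ν _ => ?_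
  ring

open scoped Pointwise in
/-- If the translates of the smearing function to the vertices of a 2-simplex are supported in a
convex set, then so is its surface form. -/
theorem tsupport_surfaceForm_subset {c : Simplex 2} {o : Set Spacetime} (ho : Convex ℝ o)
    (h : ∀ i, ∀ y ∈ tsupport c.smear.fn, c.vtx i + y ∈ o) (μ ν : Fin 4) :
    tsupport (surfaceForm c μ ν) ⊆ o := by
  -- Compact plus closed is closed, so this sum contains the topological support once it contains
  -- the points where the form is nonzero. Barycentric coordinates place the sum inside the convex
  -- set.
  have hcl : IsClosed (triangle c '' Δ₂ + tsupport c.smear.fn) :=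
    (isClosed_tsupport _).add_left_of_isCompact (isCompact_Δ₂.image (continuous_triangle c))
  have hsub : triangle c '' Δ₂ + tsupport c.smear.fn ⊆ o := by
    rintro _ ⟨_, ⟨t, ⟨h1, h2, h3⟩, rfl⟩, y, hy, rfl⟩
    have e : triangle c t + y = (1 - t.1 - t.2) • (c.vtx 0 + y) + t.1 • (c.vtx 1 + y) +
        t.2 • (c.vtx 2 + y) := by
      rw [triangle]; module
    change triangle c t + y ∈ o
    rw [e]
    have := ho.sum_mem (t := Finset.univ) (w := ![1 - t.1 - t.2, t.1, t.2])
      (z := fun i => c.vtx i + y) (by intro i _; fin_cases i <;> simp <;> linarith)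
      (by simp [Fin.sum_univ_three]; ring) (fun i _ => h i y hy)
    simpa [Fin.sum_univ_three] using this
  refine (closure_minimal (fun x hx => ?_) hcl).trans hsub
  by_contra hx'
  refine hx ?_
  rw [surfaceForm_apply]
  have : ∀ t ∈ Δ₂, c.smear.fn (x - triangle c t) = 0 := fun t ht => by
    by_contra hne
    exact hx' ⟨triangle c t, ⟨t, ht, rfl⟩, x - triangle c t,
      subset_tsupport _ hne, add_sub_cancel _ _⟩
  rw [setIntegral_congr_fun isCompact_Δ₂.measurableSet this]
  simp

/-! ### The parametrization of the standard simplex by the square -/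

/-- The derivative of `(s, t) ↦ (t (1 - s), t s)`. -/
def fderivSquareToSimplex (r : ℝ × ℝ) : ℝ × ℝ →L[ℝ] ℝ × ℝ :=
  (Matrix.toLin (.finTwoProd ℝ) (.finTwoProd ℝ)
    !![-r.2, 1 - r.1; r.2, r.1]).toContinuousLinearMap

theorem hasFDerivAt_squareToSimplex (r : ℝ × ℝ) :
    HasFDerivAt (fun r : ℝ × ℝ => (r.2 * (1 - r.1), r.2 * r.1)) (fderivSquareToSimplex r) r := by
  unfold fderivSquareToSimplex
  rw [Matrix.toLin_finTwoProd_toContinuousLinearMap]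
  have h1 : HasFDerivAt (fun r : ℝ × ℝ => r.1) (ContinuousLinearMap.fst ℝ ℝ ℝ) r := hasFDerivAt_fst
  have h2 : HasFDerivAt (fun r : ℝ × ℝ => r.2) (ContinuousLinearMap.snd ℝ ℝ ℝ) r := hasFDerivAt_snd
  have h := (h2.mul (h1.const_sub 1)).prodMk (h2.mul h1)
  refine h.congr_fderiv ?_
  ext <;> simp

theorem det_fderivSquareToSimplex (r : ℝ × ℝ) : (fderivSquareToSimplex r).det = -r.2 := by
  unfold fderivSquareToSimplex
  simp only [LinearMap.det_toContinuousLinearMap, LinearMap.det_toLin, Matrix.det_fin_two_of]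
  ring

/-- Change of variables with absolute Jacobian t. The side t = 0 of the square collapses to the
origin, so injectivity holds only on the half-open square, whose image misses the null set {0}. The
side may be restored because the integrand carries the factor t. -/
theorem setIntegral_standardSimplex (g : ℝ × ℝ → ℝ) :
    ∫ t in Δ₂, g t = ∫ r in Set.Icc (0 : ℝ) 1 ×ˢ Set.Icc (0 : ℝ) 1,
      r.2 * g (r.2 * (1 - r.1), r.2 * r.1) := by
  have himage : (fun r : ℝ × ℝ => (r.2 * (1 - r.1), r.2 * r.1)) ''
      (Set.Icc (0 : ℝ) 1 ×ˢ Set.Ioc (0 : ℝ) 1) = Δ₂ \ {0} := by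
    ext ⟨a, b⟩
    constructor
    · rintro ⟨⟨s, t⟩, ⟨⟨hs0, hs1⟩, ht0, ht1⟩, h⟩
      simp only at hs0 hs1 ht0 ht1
      simp only [Prod.mk.injEq] at h
      obtain ⟨rfl, rfl⟩ := h
      refine ⟨⟨mul_nonneg ht0.le (by linarith), mul_nonneg ht0.le hs0, ?_⟩, fun h => ?_⟩
      · simp only; nlinarith
      · simp only [Set.mem_singleton_iff, Prod.mk_eq_zero] at h
        linarith [h.1, h.2]
    · rintro ⟨⟨ha, hb, hab⟩, hne⟩
      simp only at ha hb hab
      have hpos : 0 < a + b := by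
        rcases (add_nonneg ha hb).eq_or_lt with h | h
        · exact absurd (Prod.ext (by simp only [Prod.fst_zero]; linarith)
            (by simp only [Prod.snd_zero]; linarith)) hne
        · exact h
      refine ⟨(b / (a + b), a + b), ⟨⟨by positivity, ?_⟩, hpos, hab⟩, ?_⟩
      · rw [div_le_one hpos]; linarith
      · ext <;> simp only <;> field_simp
        ring
  have hinj : Set.InjOn (fun r : ℝ × ℝ => (r.2 * (1 - r.1), r.2 * r.1))
      (Set.Icc (0 : ℝ) 1 ×ˢ Set.Ioc (0 : ℝ) 1) := by
    rintro ⟨s, t⟩ ⟨-, ht, -⟩ ⟨s', t'⟩ - h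
    simp only [Prod.mk.injEq] at h ht
    have e : t = t' := by linarith [h.1, h.2]
    subst e
    exact Prod.ext (mul_left_cancel₀ ht.ne' h.2) rfl
  have h1 := integral_image_eq_integral_abs_det_fderiv_smul volume
    (measurableSet_Icc.prod measurableSet_Ioc)
    (fun r _ => (hasFDerivAt_squareToSimplex r).hasFDerivWithinAt) hinj g
  have h0 : (volume : Measure (ℝ × ℝ)) {0} = 0 := measure_singleton _
  rw [himage, setIntegral_congr_set (sdiff_null_ae_eq_self h0)] at h1
  rw [h1, setIntegral_eq_of_subset_of_forall_sdiff_eq_zero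
    (s := Set.Icc (0 : ℝ) 1 ×ˢ Set.Ioc (0 : ℝ) 1) (measurableSet_Icc.prod measurableSet_Icc)
    (Set.prod_mono_right Set.Ioc_subset_Icc_self)]
  · refine setIntegral_congr_fun (measurableSet_Icc.prod measurableSet_Ioc) fun r hr => ?_
    simp only [det_fderivSquareToSimplex, abs_neg, smul_eq_mul, abs_of_pos hr.2.1]
  · rintro ⟨s, t⟩ ⟨⟨hs, ht0, ht1⟩, hn⟩
    simp only at hs ht0 ht1 ⊢
    have : t = 0 := by
      by_contra hne
      exact hn ⟨hs, lt_of_le_of_ne ht0 (Ne.symm hne), ht1⟩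
    rw [this, zero_mul]

/-- The antisymmetric parts of the tensor of the potential form and of the surface form of the cone
agree. -/
theorem lineTensor_sub_lineTensor (a : Simplex 0) (b : Simplex 1) (μ ν : Fin 4) :
    lineTensor (a.vtx 0) b μ ν - lineTensor (a.vtx 0) b ν μ = surfaceForm (cone a b) μ ν := by
  ext x
  have hint : ∀ κ l : Fin 4, IntegrableOn (fun r : ℝ × ℝ =>
      ((line b r.1 - a.vtx 0) κ * r.2 * (b.vtx 1 - b.vtx 0) l) *
        b.smear.fn (x - (a.vtx 0 + r.2 • (line b r.1 - a.vtx 0))))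
      (Set.Icc (0 : ℝ) 1 ×ˢ Set.Icc (0 : ℝ) 1) := fun κ l => by
    refine ContinuousOn.integrableOn_compact (isCompact_Icc.prod isCompact_Icc)
      (Continuous.continuousOn ?_)
    have := continuous_line b
    have := b.smear.fn.continuous
    fun_prop
  rw [sub_apply, lineTensor_apply, lineTensor_apply, ← integral_sub (hint μ ν) (hint ν μ),
    surfaceForm_apply, setIntegral_standardSimplex, ← integral_const_mul]
  refine integral_congr_ae (Filter.Eventually.of_forall fun r => ?_)
  have e : a.vtx 0 + r.2 • (line b r.1 - a.vtx 0) =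
      triangle (cone a b) (r.2 * (1 - r.1), r.2 * r.1) := by
    simp only [triangle, cone, line]
    change _ = a.vtx 0 + ((r.2 * (1 - r.1)) • (b.vtx 0 - a.vtx 0) +
      (r.2 * r.1) • (b.vtx 1 - a.vtx 0))
    module
  simp only [e]
  -- With z the pole, the bivector (r(s) - z) ∧ (b₁ - b₀) does not depend on s and equals (b₀ - z) ∧
  -- (b₁ - z).
  change _ = ((b.vtx 0 - a.vtx 0) μ * (b.vtx 1 - a.vtx 0) ν -
    (b.vtx 1 - a.vtx 0) μ * (b.vtx 0 - a.vtx 0) ν) * (r.2 * b.smear.fn _)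
  simp only [line, Pi.sub_apply, Pi.add_apply, Pi.smul_apply, smul_eq_mul]
  ring

/-! ### Symmetries, covariance and locality of w^em, and its potential form. -/

namespace QuantumEMField

variable {H : Type*} [NormedAddCommGroup H] [InnerProductSpace ℂ H] [CompleteSpace H]

/-- Since F is antisymmetric, twice the contraction with T is the contraction with T minus its
transpose. -/
theorem field_congr_of_sub_eq (𝔽 : QuantumEMField H) {S T : Fin 4 → Fin 4 → 𝓢(Spacetime, ℝ)}
    (h : ∀ μ ν, S μ ν - S ν μ = T μ ν - T ν μ) : 𝔽.field S = 𝔽.field T := by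
  have key : ∀ T : Fin 4 → Fin 4 → 𝓢(Spacetime, ℝ),
      (2 : ℝ) • 𝔽.field T = ∑ μ, ∑ ν, 𝔽.F μ ν (T μ ν - T ν μ) := by
    intro T
    have : 𝔽.field T = -∑ μ, ∑ ν, 𝔽.F μ ν (T ν μ) := by
      rw [field, Finset.sum_comm, ← Finset.sum_neg_distrib]
      refine Finset.sum_congr rfl fun μ _ => ?_
      rw [← Finset.sum_neg_distrib]
      exact Finset.sum_congr rfl fun ν _ => 𝔽.antisymm ν μ _
    simp only [map_sub, Finset.sum_sub_distrib]
    rw [two_smul]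
    nth_rw 2 [this]
    rw [sub_eq_add_neg, field]
  have h2 : (2 : ℝ) • 𝔽.field S = (2 : ℝ) • 𝔽.field T := by simp only [key, h]
  exact smul_right_injective _ (two_ne_zero) h2

theorem wEm_eq (𝔽 : QuantumEMField H) (c : Simplex 2) :
    𝔽.wEm c = 𝔽.expField fun μ ν => (1 / 2 : ℝ) • surfaceForm c μ ν := rfl

theorem wEm_eq_one (𝔽 : QuantumEMField H) {c : Simplex 2}
    (h : c.vtx 1 = c.vtx 0 ∨ c.vtx 2 = c.vtx 0 ∨ c.vtx 1 = c.vtx 2) : 𝔽.wEm c = 1 := by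
  rw [wEm_eq]
  refine 𝔽.expField_eq_one ?_
  simp only [field, surfaceForm_eq_zero h, smul_zero, map_zero, Finset.sum_const_zero]

theorem wEm_swap (𝔽 : QuantumEMField H) {c c' : Simplex 2} (h0 : c'.vtx 0 = c.vtx 0)
    (h1 : c'.vtx 1 = c.vtx 2) (h2 : c'.vtx 2 = c.vtx 1) (hf : c'.smear = c.smear) :
    𝔽.wEm c' = star (𝔽.wEm c) := by
  rw [wEm_eq, wEm_eq, ← expField_neg]
  congr 1
  funext μ ν
  rw [surfaceForm_swap h0 h1 h2 hf, smul_neg]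
  rfl

/-- The matrix factors in the covariance law of F are exactly those by which the surface form of the
moved simplex is expanded, so only the order of summation differs. -/
theorem wEm_covariant (𝔽 : QuantumEMField H) (P : Poincare) (c : Simplex 2) :
    𝔽.U P * 𝔽.wEm c * star (𝔽.U P) = 𝔽.wEm (c.move P) := by
  rw [wEm_eq, wEm_eq]
  refine 𝔽.expField_conj P fun χ => ?_
  simp only [field, LinearMap.sum_apply, Submodule.coe_sum, map_sum, 𝔽.covariance]
  simp only [surfaceForm_move, map_smul, map_sum, LinearMap.sum_apply, LinearMap.smul_apply,
    Submodule.coe_sum, Finset.smul_sum, poincareTest]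
  have e : ∀ f : Fin 4 → Fin 4 → Fin 4 → Fin 4 → H,
      ∑ μ, ∑ ν, ∑ α, ∑ β, f μ ν α β = ∑ α, ∑ β, ∑ μ, ∑ ν, f μ ν α β := fun f => by
    calc ∑ μ, ∑ ν, ∑ α, ∑ β, f μ ν α β = ∑ μ, ∑ α, ∑ ν, ∑ β, f μ ν α β :=
          Finset.sum_congr rfl fun _ _ => Finset.sum_comm
      _ = ∑ α, ∑ μ, ∑ ν, ∑ β, f μ ν α β := Finset.sum_comm
      _ = ∑ α, ∑ μ, ∑ β, ∑ ν, f μ ν α β :=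
          Finset.sum_congr rfl fun _ _ => Finset.sum_congr rfl fun _ _ => Finset.sum_comm
      _ = _ := Finset.sum_congr rfl fun _ _ => Finset.sum_comm
  rw [e]
  refine Finset.sum_congr rfl fun α _ => Finset.sum_congr rfl fun β _ =>
    Finset.sum_congr rfl fun μ _ => Finset.sum_congr rfl fun ν _ => ?_
  rw [lorentzTest, map_smul, map_smul, map_smul]
  exact smul_comm _ _ _

theorem wEm_commute (𝔽 : QuantumEMField H) {c c' : Simplex 2} {o o' : Set Spacetime}
    (ho : Convex ℝ o) (ho' : Convex ℝ o') (hd : CausallyDisjoint o o')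
    (h : ∀ i, ∀ y ∈ tsupport c.smear.fn, c.vtx i + y ∈ o)
    (h' : ∀ i, ∀ y ∈ tsupport c'.smear.fn, c'.vtx i + y ∈ o') :
    Commute (𝔽.wEm c) (𝔽.wEm c') := by
  have hs : ∀ f : 𝓢(Spacetime, ℝ), tsupport ((1 / 2 : ℝ) • f) ⊆ tsupport f := fun f =>
    closure_mono fun x hx hfx => hx (by rw [smul_apply, hfx, smul_zero])
  rw [wEm_eq, wEm_eq]
  exact 𝔽.commute_expField_of_causallyDisjoint fun μ ν α β x hx y hy =>
    hd x (tsupport_surfaceForm_subset ho h μ ν (hs _ hx))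
      y (tsupport_surfaceForm_subset ho' h' α β (hs _ hy))

/-- The surface form is already antisymmetric and the line tensor is not; the factor 1/2 makes their
antisymmetric parts coincide. -/
theorem wEm_cone_eq_expI_lineIntegral (𝔽 : QuantumEMField H) (a : Simplex 0) (b : Simplex 1) :
    𝔽.wEm (cone a b) = expI (𝔽.lineIntegral (a.vtx 0) b).closure := by
  rw [wEm_eq]
  refine 𝔽.expField_congr (𝔽.field_congr_of_sub_eq fun μ ν => ?_)
  rw [lineTensor_sub_lineTensor, ← lineTensor_sub_lineTensor, ← lineTensor_sub_lineTensor]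
  module

end QuantumEMField

/-! ### Double cones -/

theorem minkowski_eq (x y : Spacetime) :
    minkowski x y = x 0 * y 0 - x 1 * y 1 - x 2 * y 2 - x 3 * y 3 := by
  simp [minkowski, metric, dotProduct, Matrix.mulVec_diagonal, Fin.sum_univ_four]
  ring

/-- Makes double cones bounded: the time component dominates the sup norm. -/
theorem abs_le_of_mem_forwardCone {v : Spacetime} (hv : v ∈ forwardCone) (i : Fin 4) :
    |v i| ≤ v 0 := by
  obtain ⟨h, h0⟩ := hv
  rw [minkowski_eq] at h
  refine abs_le_of_sq_le_sq ?_ h0.le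
  fin_cases i <;> simp <;> nlinarith [sq_nonneg (v 1), sq_nonneg (v 2), sq_nonneg (v 3)]

/-- Cauchy–Schwarz for the spatial parts, each of which is shorter than the time component. This
controls the cross term in the convexity of the cone. -/
theorem minkowski_nonneg_of_mem_forwardCone {v w : Spacetime} (hv : v ∈ forwardCone)
    (hw : w ∈ forwardCone) : 0 ≤ minkowski v w := by
  obtain ⟨hv, hv0⟩ := hv
  obtain ⟨hw, hw0⟩ := hw
  rw [minkowski_eq] at *
  have hcs : (v 1 * w 1 + v 2 * w 2 + v 3 * w 3) ^ 2 ≤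
      (v 1 ^ 2 + v 2 ^ 2 + v 3 ^ 2) * (w 1 ^ 2 + w 2 ^ 2 + w 3 ^ 2) := by
    nlinarith [sq_nonneg (v 1 * w 2 - v 2 * w 1),
      sq_nonneg (v 1 * w 3 - v 3 * w 1), sq_nonneg (v 2 * w 3 - v 3 * w 2)]
  have hle : (v 1 ^ 2 + v 2 ^ 2 + v 3 ^ 2) * (w 1 ^ 2 + w 2 ^ 2 + w 3 ^ 2) ≤ v 0 ^ 2 * w 0 ^ 2 := by
    gcongr <;> nlinarith
  have := (abs_le.1 (abs_le_of_sq_le_sq (a := v 1 * w 1 + v 2 * w 2 + v 3 * w 3) (b := v 0 * w 0)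
    (by rw [mul_pow]; exact hcs.trans hle) (mul_nonneg hv0.le hw0.le))).2
  linarith

theorem convex_forwardCone : Convex ℝ forwardCone := by
  intro v hv w hw s t hs ht hst
  have hvw := minkowski_nonneg_of_mem_forwardCone hv hw
  have e : minkowski (s • v + t • w) (s • v + t • w) =
      s ^ 2 * minkowski v v + t ^ 2 * minkowski w w + 2 * (s * t) * minkowski v w := by
    simp only [minkowski_eq, Pi.add_apply, Pi.smul_apply, smul_eq_mul]; ring
  have e0 : (s • v + t • w) 0 = s * v 0 + t * w 0 := rfl
  obtain ⟨hv, hv0⟩ := hv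
  obtain ⟨hw, hw0⟩ := hw
  have h3 : 0 ≤ 2 * (s * t) * minkowski v w := by positivity
  rcases hs.eq_or_lt with rfl | hs
  · have : t = 1 := by linarith
    subst this
    refine ⟨?_, ?_⟩
    · rw [e]; linarith
    · rw [e0]; linarith
  · refine ⟨?_, ?_⟩
    · rw [e]; positivity
    · rw [e0]; positivity

theorem convex_of_mem_doubleCones {o : Set Spacetime} (ho : o ∈ doubleCones) : Convex ℝ o := by
  obtain ⟨x, y, -, rfl⟩ := ho
  rintro z ⟨hz1, hz2⟩ z' ⟨hz1', hz2'⟩ s t hs ht hst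
  have hst' : s = 1 - t := by linarith
  refine ⟨?_, ?_⟩
  · convert convex_forwardCone hz1 hz1' hs ht hst using 1
    rw [hst']; module
  · convert convex_forwardCone hz2 hz2' hs ht hst using 1
    rw [hst']; module

theorem isBounded_of_mem_doubleCones {o : Set Spacetime} (ho : o ∈ doubleCones) :
    Bornology.IsBounded o := by
  obtain ⟨x, y, -, rfl⟩ := ho
  refine (Metric.isBounded_closedBall (x := x) (r := y 0 - x 0)).subset ?_
  rintro z ⟨h1, h2⟩
  have h2' : 0 < y 0 - z 0 := h2.2
  have h1' : 0 < z 0 - x 0 := h1.2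
  rw [mem_closedBall_iff_norm]
  refine (pi_norm_le_iff_of_nonneg (by linarith)).2 fun i => ?_
  have := abs_le_of_mem_forwardCone h1 i
  rw [Pi.sub_apply z x 0] at this
  rw [Real.norm_eq_abs]
  linarith

/-! ### The support of a smearing 1-simplex -/

open Filter Topology

/-- A continuous function which decays at `-∞` and whose averages over the intervals `[τ - 1, τ]`,
`τ ≤ 0`, vanish, is zero at `0`. -/
theorem eq_zero_of_averages_eq_zero {h : ℝ → ℝ} (hc : Continuous h)
    (hlim : ∀ x, Tendsto (fun n : ℕ => h (x - n)) atTop (𝓝 0))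
    (h0 : ∀ τ ≤ 0, ∫ t in (τ - 1)..τ, h t = 0) : h 0 = 0 := by
  -- The derivative of the average being zero, h has period 1 on the negative half-line; decay then
  -- makes it vanish there, and continuity at 0.
  have hder : ∀ τ : ℝ, HasDerivAt (fun τ => ∫ t in (τ - 1)..τ, h t) (h τ - h (τ - 1)) τ := by
    intro τ
    have hi : ∀ a b, IntervalIntegrable h volume a b := fun a b => hc.intervalIntegrable a b
    have e : (fun τ => ∫ t in (τ - 1)..τ, h t) =
        fun τ => (∫ t in (0 : ℝ)..τ, h t) - ∫ t in (0 : ℝ)..(τ - 1), h t :=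
      funext fun τ => (intervalIntegral.integral_interval_sub_left (hi _ _) (hi _ _)).symm
    have h1 : ∀ x : ℝ, HasDerivAt (fun τ => ∫ t in (0 : ℝ)..τ, h t) (h x) x := fun x =>
      intervalIntegral.integral_hasDerivAt_right (hi _ _)
        (hc.stronglyMeasurableAtFilter _ _) hc.continuousAt
    rw [e]
    exact (h1 τ).sub ((h1 (τ - 1)).comp_sub_const τ 1)
  have hstep : ∀ τ < 0, h τ = h (τ - 1) := by
    intro τ hτ
    have h1 : (fun τ => ∫ t in (τ - 1)..τ, h t) =ᶠ[𝓝 τ] fun _ => 0 := by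
      filter_upwards [Iio_mem_nhds hτ] with x hx using h0 x (le_of_lt hx)
    have := ((hder τ).congr_of_eventuallyEq h1.symm).unique (hasDerivAt_const τ 0)
    linarith
  have hiter : ∀ τ < 0, ∀ n : ℕ, h (τ - n) = h τ := by
    intro τ hτ n
    induction n with
    | zero => simp
    | succ n ih =>
      rw [← ih, hstep (τ - n) (by have : (0 : ℝ) ≤ n := n.cast_nonneg; linarith)]
      congr 1; push_cast; ring
  have hneg : ∀ τ < 0, h τ = 0 := fun τ hτ => by
    refine tendsto_nhds_unique ?_ (hlim τ)
    simp only [hiter τ hτ]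
    exact tendsto_const_nhds
  have hcl : IsClosed {τ | h τ = 0} := isClosed_eq hc continuous_const
  have : Set.Iio (0 : ℝ) ⊆ {τ | h τ = 0} := hneg
  have := closure_minimal this hcl
  rw [closure_Iio] at this
  exact this (Set.mem_Iic.2 le_rfl)

theorem tendsto_schwartz_add_smul (f : 𝓢(Spacetime, ℝ)) {v : Spacetime} (hv : v ≠ 0)
    (y : Spacetime) : Tendsto (fun n : ℕ => f (y + (n : ℝ) • v)) atTop (𝓝 0) := by
  have h1 : Tendsto f (cocompact Spacetime) (𝓝 0) := f.toZeroAtInfty.zero_at_infty'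
  refine h1.comp ?_
  rw [← Metric.cobounded_eq_cocompact, ← tendsto_norm_atTop_iff_cobounded]
  have h2 : Tendsto (fun n : ℕ => (n : ℝ) * ‖v‖ - ‖y‖) atTop atTop :=
    tendsto_atTop_add_const_right _ _
      (tendsto_natCast_atTop_atTop.atTop_mul_const (norm_pos_iff.2 hv))
  refine tendsto_atTop_mono (fun n => ?_) h2
  have := norm_sub_norm_le ((n : ℝ) • v) (-y)
  rw [norm_neg, sub_neg_eq_add, norm_smul, Real.norm_natCast, add_comm] at this
  exact this

theorem mem_supp₁ {b : Simplex 1} {x : Spacetime} (hb : b.vtx 0 ≠ b.vtx 1)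
    (h : ∫ s in (0 : ℝ)..1, b.smear.fn (x - line b s) ≠ 0) : x ∈ supp₁ b := by
  refine subset_tsupport _ fun h0 => h ?_
  obtain ⟨μ, hμ⟩ : ∃ μ, (b.vtx 1 - b.vtx 0) μ ≠ 0 := by
    by_contra! hcon
    exact hb (sub_eq_zero.1 (funext hcon)).symm
  have := congrFun h0 μ
  simp only [intervalIntegral.integral_mul_const, Pi.zero_apply] at this
  exact (mul_eq_zero.1 this).resolve_right hμ

/-- The translates of the smearing function to the vertices of a nondegenerate 1-simplex are
supported on segments which join points of the support of the simplex. -/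
theorem vtx_add_mem_convexJoin {b : Simplex 1} (hb : b.vtx 0 ≠ b.vtx 1) {y : Spacetime}
    (hy : b.smear.fn y ≠ 0) (i : Fin 2) : b.vtx i + y ∈ convexJoin ℝ (supp₁ b) (supp₁ b) := by
  set v := b.vtx 1 - b.vtx 0 with hv
  have hv0 : v ≠ 0 := sub_ne_zero.2 hb.symm
  -- The smearing function on the line through y along the edge: at b₀ + y + τv the 1-form of b is v
  -- times the average of h over [τ - 1, τ]. As h(0) ≠ 0, some average with τ ≤ 0 and some average
  -- with τ ≥ 1 is nonzero, and the two vertex translates, at τ = 0 and τ = 1, lie between these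
  -- points.
  set h : ℝ → ℝ := fun τ => b.smear.fn (y + τ • v) with hh
  have hc : Continuous h := by
    have := b.smear.fn.continuous
    fun_prop
  have hsupp : ∀ τ : ℝ, (∫ t in (τ - 1)..τ, h t) ≠ 0 → b.vtx 0 + y + τ • v ∈ supp₁ b := by
    intro τ hτ
    refine mem_supp₁ hb ?_
    have e : ∀ s, b.smear.fn (b.vtx 0 + y + τ • v - line b s) = h (τ - s) := fun s => by
      simp only [hh, line, ← hv]; congr 1; module
    simp only [e]
    rwa [intervalIntegral.integral_comp_sub_left, sub_zero]
  have hh0 : h 0 ≠ 0 := by simpa [hh] using hy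
  obtain ⟨τ₁, hτ₁, h₁⟩ : ∃ τ ≤ 0, (∫ t in (τ - 1)..τ, h t) ≠ 0 := by
    by_contra! hcon
    refine hh0 (eq_zero_of_averages_eq_zero hc (fun x => ?_) hcon)
    refine (tendsto_schwartz_add_smul b.smear.fn (neg_ne_zero.2 hv0) (y + x • v)).congr
      fun n => ?_
    simp only [hh]; congr 1; module
  -- The reflected function is used: the reflection of [τ - 1, τ] with τ ≤ 0 is [-τ, 1 - τ], whose
  -- right end is at least 1.
  obtain ⟨τ₂, hτ₂, h₂⟩ : ∃ τ ≥ 1, (∫ t in (τ - 1)..τ, h t) ≠ 0 := by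
    by_contra! hcon
    have := eq_zero_of_averages_eq_zero (h := fun τ => h (-τ)) (by fun_prop) (fun x => ?_)
      (fun τ hτ => ?_)
    · exact hh0 (by simpa using this)
    · refine (tendsto_schwartz_add_smul b.smear.fn hv0 (y + (-x) • v)).congr fun n => ?_
      simp only [hh]; congr 1; module
    · rw [intervalIntegral.integral_comp_neg]
      have := hcon (-(τ - 1)) (by linarith)
      rwa [show -(τ - 1) - 1 = -τ by ring] at this
  have hseg : ∀ τ, τ₁ ≤ τ → τ ≤ τ₂ → b.vtx 0 + y + τ • v ∈ convexJoin ℝ (supp₁ b) (supp₁ b) := by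
    intro τ hl hr
    have hpos : 0 < τ₂ - τ₁ := by linarith
    refine mem_convexJoin.2 ⟨_, hsupp τ₁ h₁, _, hsupp τ₂ h₂, (τ₂ - τ) / (τ₂ - τ₁),
      (τ - τ₁) / (τ₂ - τ₁), div_nonneg (by linarith) hpos.le, div_nonneg (by linarith) hpos.le,
      by field_simp; ring, ?_⟩
    match_scalars <;> field_simp <;> ring
  fin_cases i
  · simpa using hseg 0 hτ₁ (by linarith)
  · have := hseg 1 (by linarith) hτ₂
    rw [one_smul, hv] at this
    convert this using 1
    change b.vtx 1 + y = _
    module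

theorem isCompact_convexJoin {s t : Set Spacetime} (hs : IsCompact s) (ht : IsCompact t) :
    IsCompact (convexJoin ℝ s t) := by
  have h : convexJoin ℝ s t = (fun p : (Spacetime × Spacetime) × ℝ =>
      (1 - p.2) • p.1.1 + p.2 • p.1.2) '' ((s ×ˢ t) ×ˢ Set.Icc 0 1) := by
    ext x
    simp only [mem_convexJoin, segment_eq_image, Set.mem_image, Set.mem_prod, Prod.exists]
    constructor
    · rintro ⟨p, hp, q, hq, θ, hθ, rfl⟩
      exact ⟨p, q, θ, ⟨⟨hp, hq⟩, hθ⟩, rfl⟩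
    · rintro ⟨p, q, θ, ⟨⟨hp, hq⟩, hθ⟩, rfl⟩
      exact ⟨p, hp, q, hq, θ, hθ, rfl⟩
  rw [h]
  exact ((hs.prod ht).prod isCompact_Icc).image (by fun_prop)

/-- Inside a bounded double cone the support of b is compact. The set of segments joining its points
is then closed and reaches the whole support of the smearing function, not just its nonvanishing
points. Convexity of the double cone finishes. -/
theorem vtx_add_mem_of_supp₁_subset {b : Simplex 1} (hb : b.vtx 0 ≠ b.vtx 1) {o : Set Spacetime}
    (ho : o ∈ doubleCones) (hs : supp₁ b ⊆ o) {y : Spacetime} (hy : y ∈ tsupport b.smear.fn)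
    (i : Fin 2) : b.vtx i + y ∈ o := by
  have hcpt : IsCompact (supp₁ b) :=
    Metric.isCompact_of_isClosed_isBounded (isClosed_tsupport _)
      ((isBounded_of_mem_doubleCones ho).subset hs)
  have hcl : IsClosed {y : Spacetime | b.vtx i + y ∈ convexJoin ℝ (supp₁ b) (supp₁ b)} :=
    (isCompact_convexJoin hcpt hcpt).isClosed.preimage (by fun_prop)
  obtain ⟨p, hp, q, hq, h⟩ := mem_convexJoin.1
    (closure_minimal (fun z hz => vtx_add_mem_convexJoin hb hz i) hcl hy)
  exact (convex_of_mem_doubleCones ho).segment_subset (hs hp) (hs hq) h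

/-! ### Paths and reduced words -/

theorem isPath_cons_iff {b : Simplex 1} {w : Word} {a a' : Simplex 0} :
    IsPath (b :: w) a a' ↔
      a' = b.face 0 ∧ ((w = [] ∧ a = b.face 1) ∨ IsPath w a (b.face 1)) := by
  constructor
  · intro h
    generalize hl : b :: w = l at h
    cases h with
    | single b' =>
      obtain ⟨rfl, rfl⟩ := List.cons.inj hl
      exact ⟨rfl, Or.inl ⟨rfl, rfl⟩⟩
    | cons b' h' =>
      obtain ⟨rfl, rfl⟩ := List.cons.inj hl
      exact ⟨rfl, Or.inr h'⟩
  · rintro ⟨rfl, ⟨rfl, rfl⟩ | h⟩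
    · exact IsPath.single b
    · exact IsPath.cons b h

theorem Simplex.degenerated_iff {b : Simplex 1} : b.Degenerated ↔ b.vtx 0 = b.vtx 1 := by
  constructor
  · rintro ⟨i, j, hij, h⟩
    fin_cases i <;> fin_cases j
    · exact absurd rfl hij
    · exact h
    · exact h.symm
    · exact absurd rfl hij
  · exact fun h => ⟨0, 1, by decide, h⟩

theorem Simplex.Degenerated.face_eq {b : Simplex 1} (hb : b.Degenerated) : b.face 0 = b.face 1 := by
  have h := degenerated_iff.1 hb
  ext j
  · fin_cases j
    exact congrFun h.symm _
  · rfl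

/-- Deleting a degenerate letter or a pair b b̄ does not change the end points, but may leave the
empty word, which is not a path; hence the alternative. -/
theorem IsPath.reduce {w : Word} {a a' : Simplex 0} (h : IsPath w a a') :
    (reduce w = [] ∧ a = a') ∨ IsPath (reduce w) a a' := by
  induction h with
  | single b =>
    by_cases hb : b.Degenerated
    · exact Or.inl ⟨by simp [EMLoops.reduce, hb], hb.face_eq.symm⟩
    · right
      have : EMLoops.reduce [b] = [b] := by simp [EMLoops.reduce, hb]
      rw [this]
      exact IsPath.single b
  | @cons b w a _ ih =>
    by_cases hb : b.Degenerated
    · have : EMLoops.reduce (b :: w) = EMLoops.reduce w := by simp [EMLoops.reduce, hb]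
      rw [this, hb.face_eq]
      exact ih
    · rw [EMLoops.reduce, if_neg hb]
      rcases hw : EMLoops.reduce w with _ | ⟨b', w'⟩
      · simp only [hw] at ih ⊢
        rcases ih with ⟨-, rfl⟩ | h
        · exact Or.inr (IsPath.single b)
        · cases h
      · rw [hw] at ih
        have hp := ih.resolve_left (by simp)
        simp only
        split_ifs with hopp
        · rw [hopp, isPath_cons_iff, Simplex.opp_face_one] at hp
          rcases hp.2 with ⟨rfl, rfl⟩ | h
          · exact Or.inl ⟨rfl, rfl⟩
          · exact Or.inr h
        · exact Or.inr (IsPath.cons b hp)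

theorem not_degenerated_of_mem_reduce {w : Word} {b : Simplex 1} (h : b ∈ reduce w) :
    ¬ b.Degenerated := by
  induction w with
  | nil => simp [reduce] at h
  | cons c w ih =>
    rw [reduce] at h
    split_ifs at h with hc
    · exact ih h
    · rcases hw : reduce w with _ | ⟨b', w'⟩
      · simp only [hw, List.mem_singleton] at h
        rwa [h]
      · rw [hw] at ih
        simp only [hw] at h
        split_ifs at h with hopp
        · exact ih (List.mem_cons_of_mem _ h)
        · rcases List.mem_cons.1 h with rfl | h
          · exact hc
          · exact ih h

theorem IsPath.smear_eq {w : Word} {a a' : Simplex 0} (h : IsPath w a a') :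
    ∀ b ∈ w, b.smear = a.smear := by
  have key : a'.smear = a.smear ∧ ∀ b ∈ w, b.smear = a.smear := by
    induction h with
    | single b => exact ⟨rfl, by simp [Simplex.face]⟩
    | cons b _ ih =>
      have hb : b.smear = _ := ih.1
      refine ⟨hb, fun c hc => ?_⟩
      rcases List.mem_cons.1 hc with rfl | hc
      · exact hb
      · exact ih.2 c hc
  exact key.2

theorem IsPath.exists_start {w : Word} {a a' : Simplex 0} (h : IsPath w a a') :
    ∃ b ∈ w, b.face 1 = a := by
  induction h with
  | single b => exact ⟨b, by simp, rfl⟩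
  | cons b _ ih =>
    obtain ⟨c, hc, h⟩ := ih
    exact ⟨c, List.mem_cons_of_mem _ hc, h⟩

/-- The cones over the letters of the reduced word of a loop are localized in every double cone
which contains the support of the loop. -/
theorem cone_vtx_add_mem {w : Word} {a : Simplex 0} (h : IsPath w a a) {o : Set Spacetime}
    (ho : o ∈ doubleCones) (hs : wordSupport w ⊆ o) {b : Simplex 1} (hb : b ∈ reduce w)
    (i : Fin 3) {y : Spacetime} (hy : y ∈ tsupport (cone a b).smear.fn) :
    (cone a b).vtx i + y ∈ o := by
  have hr := h.reduce.resolve_left fun hn => by simp [hn.1] at hb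
  have hmem : ∀ c ∈ reduce w, ∀ (j : Fin 2), c.vtx j + y ∈ o := fun c hc j => by
    refine vtx_add_mem_of_supp₁_subset
      (fun he => not_degenerated_of_mem_reduce hc (Simplex.degenerated_iff.2 he)) ho
      ((Set.subset_biUnion_of_mem (u := fun b => supp₁ b) hc).trans hs) ?_ j
    rw [hr.smear_eq c hc, ← hr.smear_eq b hb]
    exact hy
  fin_cases i
  -- The apex of the cone is localized because the pole is the starting vertex of a letter of the
  -- reduced loop.
  · obtain ⟨c, hc, rfl⟩ := hr.exists_start
    exact hmem c hc 0
  · exact hmem b hb 0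
  · exact hmem b hb 1

theorem cone_move (P : Poincare) (a : Simplex 0) (b : Simplex 1) :
    cone (a.move P) (b.move P) = (cone a b).move P := by
  ext j
  · fin_cases j <;> rfl
  · rfl

/-! ### Cone products and the connection systems. -/

namespace QuantumEMField

variable {H : Type*} [NormedAddCommGroup H] [InnerProductSpace ℂ H] [CompleteSpace H]

/-- The product `w^em(h^a(b_n)) ⋯ w^em(h^a(b_1))` for an arbitrary word `b_n ⋯ b_1`. -/
def coneProd (𝔽 : QuantumEMField H) (a : Simplex 0) (w : Word) : unitary (H →L[ℂ] H) :=
  (w.map fun b => 𝔽.wEm (cone a b)).prod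

theorem coneProd_cons (𝔽 : QuantumEMField H) (a : Simplex 0) (b : Simplex 1) (w : Word) :
    𝔽.coneProd a (b :: w) = 𝔽.wEm (cone a b) * 𝔽.coneProd a w := by
  simp [coneProd]

theorem coneProd_singleton (𝔽 : QuantumEMField H) (a : Simplex 0) (b : Simplex 1) :
    𝔽.coneProd a [b] = 𝔽.wEm (cone a b) := by
  simp [coneProd]

theorem coneProd_append (𝔽 : QuantumEMField H) (a : Simplex 0) (w w' : Word) :
    𝔽.coneProd a (w ++ w') = 𝔽.coneProd a w * 𝔽.coneProd a w' := by
  simp [coneProd]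

theorem wEm_cone_opp (𝔽 : QuantumEMField H) (a : Simplex 0) (b : Simplex 1) :
    𝔽.wEm (cone a b.opp) = star (𝔽.wEm (cone a b)) :=
  𝔽.wEm_swap rfl rfl rfl rfl

theorem wEm_cone_of_degenerated (𝔽 : QuantumEMField H) (a : Simplex 0) {b : Simplex 1}
    (hb : b.Degenerated) : 𝔽.wEm (cone a b) = 1 :=
  𝔽.wEm_eq_one (Or.inr (Or.inr (Simplex.degenerated_iff.1 hb)))

theorem coneProd_opp (𝔽 : QuantumEMField H) (a : Simplex 0) (w : Word) :
    𝔽.coneProd a (Word.opp w) = star (𝔽.coneProd a w) := by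
  induction w with
  | nil => simp [coneProd, Word.opp]
  | cons b w ih =>
    have e : Word.opp (b :: w) = Word.opp w ++ [b.opp] := by simp [Word.opp]
    rw [e, coneProd_append, ih, coneProd_singleton, wEm_cone_opp, coneProd_cons, star_mul]

/-- Needed for causality: the support of a word constrains only the letters that survive reduction,
and the removed ones contribute 1 or cancel. -/
theorem coneProd_reduce (𝔽 : QuantumEMField H) (a : Simplex 0) (w : Word) :
    𝔽.coneProd a (reduce w) = 𝔽.coneProd a w := by
  induction w with
  | nil => rfl
  | cons b w ih =>
    rw [coneProd_cons, reduce]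
    split_ifs with hb
    · rw [ih, 𝔽.wEm_cone_of_degenerated a hb, one_mul]
    · rcases hw : reduce w with _ | ⟨b', w'⟩
      · rw [hw] at ih
        simp only
        rw [← ih, coneProd_cons]
      · rw [hw] at ih
        simp only
        split_ifs with hopp
        · rw [← ih, coneProd_cons, hopp, wEm_cone_opp, ← mul_assoc, Unitary.mul_star_self, one_mul]
        · rw [← ih, coneProd_cons]

theorem coneProd_covariant (𝔽 : QuantumEMField H) (P : Poincare) (a : Simplex 0) (w : Word) :
    𝔽.U P * 𝔽.coneProd a w * star (𝔽.U P) = 𝔽.coneProd (a.move P) (w.map (Simplex.move P)) := by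
  induction w with
  | nil => simp [coneProd]
  | cons b w ih =>
    rw [List.map_cons, coneProd_cons, coneProd_cons, ← ih, cone_move, ← wEm_covariant]
    simp only [mul_assoc]
    rw [← mul_assoc (star (𝔽.U P)) (𝔽.U P), Unitary.star_mul_self, one_mul]

theorem coneProd_commute (𝔽 : QuantumEMField H) {o o' : Set Spacetime} (ho : o ∈ doubleCones)
    (ho' : o' ∈ doubleCones) (hd : CausallyDisjoint o o') {a a' : Simplex 0} {w w' : Word}
    (hw : IsPath w a a) (hw' : IsPath w' a' a') (hs : wordSupport w ⊆ o)
    (hs' : wordSupport w' ⊆ o') : Commute (𝔽.coneProd a w) (𝔽.coneProd a' w') := by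
  rw [← coneProd_reduce, ← 𝔽.coneProd_reduce a' w']
  refine Commute.list_prod_left _ _ fun x hx => Commute.list_prod_right _ _ fun x' hx' => ?_
  obtain ⟨b, hb, rfl⟩ := List.mem_map.1 hx
  obtain ⟨b', hb', rfl⟩ := List.mem_map.1 hx'
  exact 𝔽.wEm_commute (convex_of_mem_doubleCones ho) (convex_of_mem_doubleCones ho') hd
    (fun i y hy => cone_vtx_add_mem hw ho hs hb i hy)
    (fun i y hy => cone_vtx_add_mem hw' ho' hs' hb' i hy)

theorem coneProd_path_base (𝔽 : QuantumEMField H) (Γ : PathFrameSystem) (a : Simplex 0) :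
    𝔽.coneProd a (Γ.path a (Component.base a)) = 1 := by
  rw [Γ.path_self, coneProd_singleton]
  exact 𝔽.wEm_cone_of_degenerated a (Simplex.degenerated_iff.2 rfl)

/-- The cone with apex a over a segment ending at a has two coinciding vertices. -/
theorem coneProd_euclidean (𝔽 : QuantumEMField H) (a : Simplex 0) (a' : Component 0 a) :
    𝔽.coneProd a (euclidean.path a a') = 1 := by
  change 𝔽.coneProd a [(segment a a').opp] = 1
  rw [coneProd_singleton]
  exact 𝔽.wEm_eq_one (Or.inr (Or.inl rfl))

theorem uEm_eq (𝔽 : QuantumEMField H) (Γ : PathFrameSystem) (a : Simplex 0) (b : Component 1 a) :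
    𝔽.uEm Γ a b = 𝔽.coneProd a (Γ.path a (b.face 0)) * 𝔽.wEm (cone a b.1) *
      star (𝔽.coneProd a (Γ.path a (b.face 1))) := by
  change 𝔽.coneProd a (Γ.path a (b.face 0) ++ ([b.1] ++ Word.opp (Γ.path a (b.face 1)))) = _
  rw [coneProd_append, coneProd_append, coneProd_singleton, coneProd_opp, mul_assoc]

theorem uEm_euclidean (𝔽 : QuantumEMField H) (a : Simplex 0) (b : Component 1 a) :
    𝔽.uEm euclidean a b = 𝔽.wEm (cone a b.1) := by
  rw [uEm_eq, coneProd_euclidean, coneProd_euclidean, one_mul, star_one, mul_one]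

theorem gEm_eq (𝔽 : QuantumEMField H) (Γ : PathFrameSystem) (a : Simplex 0) (a' : Component 0 a) :
    𝔽.gEm Γ a a' = 𝔽.coneProd a (Γ.path a a') := by
  change 𝔽.coneProd a (Γ.path a a' ++ Word.opp (euclidean.path a a')) = _
  rw [coneProd_append, coneProd_opp, coneProd_euclidean, star_one, mul_one]

/-- The frame factors of consecutive letters cancel. Arbitrary end points are allowed for the
induction; for loops over the pole the outer factors are 1 as well, so the value no longer depends
on the frame. -/
theorem onWord_uEm (𝔽 : QuantumEMField H) (Γ : PathFrameSystem) (a : Simplex 0)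
    (p : List (Component 1 a)) (x y : Component 0 a) (hp : IsPath (p.map Subtype.val) x.1 y.1) :
    onWord (𝔽.uEm Γ) a p = 𝔽.coneProd a (Γ.path a y) * 𝔽.coneProd a (p.map Subtype.val) *
      star (𝔽.coneProd a (Γ.path a x)) := by
  induction p generalizing y with
  | nil => cases hp
  | cons b p ih =>
    replace hp := isPath_cons_iff.1 (show IsPath (b.1 :: p.map Subtype.val) x.1 y.1 from hp)
    have hy : y = b.face 0 := Subtype.ext hp.1
    have e : onWord (𝔽.uEm Γ) a (b :: p) = 𝔽.uEm Γ a b * onWord (𝔽.uEm Γ) a p := by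
      simp [onWord]
    have e' : 𝔽.coneProd a ((b :: p).map Subtype.val) =
        𝔽.wEm (cone a b.1) * 𝔽.coneProd a (p.map Subtype.val) := 𝔽.coneProd_cons a b.1 _
    rw [e, e', uEm_eq, hy]
    rcases hp.2 with ⟨hnil, hx⟩ | h
    · obtain rfl : p = [] := List.map_eq_nil_iff.1 hnil
      obtain rfl : x = b.face 1 := Subtype.ext hx
      have h1 : 𝔽.coneProd a (([] : List (Component 1 a)).map Subtype.val) = 1 := rfl
      have h2 : onWord (𝔽.uEm Γ) a [] = 1 := rfl
      rw [h1, h2, mul_one, mul_one]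
    · rw [ih (b.face 1) h]
      simp only [mul_assoc]
      rw [← mul_assoc (star (𝔽.coneProd a (Γ.path a (b.face 1)))), Unitary.star_mul_self, one_mul]

theorem uEm_of_degenerated (𝔽 : QuantumEMField H) (Γ : PathFrameSystem) {a : Simplex 0}
    {b : Component 1 a} (hb : b.1.Degenerated) : 𝔽.uEm Γ a b = 1 := by
  have h : b.face 0 = b.face 1 := Subtype.ext hb.face_eq
  rw [uEm_eq, 𝔽.wEm_cone_of_degenerated a hb, h, mul_one, Unitary.mul_star_self]

theorem uEm_isCausalCovariantConnection (𝔽 : QuantumEMField H) (Γ : PathFrameSystem) :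
    IsCausalCovariantConnection (𝔽.uEm Γ) 𝔽.U where
  connection := by
    refine ⟨fun a b => ?_, fun a a' => ?_⟩
    · have h0 : b.opp.face 0 = b.face 1 := Subtype.ext b.1.opp_face_zero
      have h1 : b.opp.face 1 = b.face 0 := Subtype.ext b.1.opp_face_one
      have h2 : b.opp.1 = b.1.opp := rfl
      rw [uEm_eq, uEm_eq, h0, h1, h2, wEm_cone_opp]
      simp only [star_mul, star_star, mul_assoc]
    · exact 𝔽.uEm_of_degenerated Γ (Simplex.degenerated_iff.2 rfl)
  causal := by
    intro o ho o' ho' hd a a' p p' hp hp'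
    rw [𝔽.onWord_uEm Γ a p (Component.base a) (Component.base a) hp.1,
      𝔽.onWord_uEm Γ a' p' (Component.base a') (Component.base a') hp'.1,
      coneProd_path_base, coneProd_path_base, one_mul, one_mul, star_one, mul_one, mul_one]
    exact 𝔽.coneProd_commute ho ho' hd hp.1 hp'.1 hp.2 hp'.2
  covariant := by
    intro P a b
    have h : ∀ i, (b.move P).face i = (b.face i).move P := fun i => rfl
    -- Covariance holds for the cone product of the whole frame loop; covariance of the path-frame
    -- system identifies the moved loop with the frame loop of the moved data.
    have e := 𝔽.coneProd_covariant P a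
      (Γ.path a (b.face 0) ++ ([b.1] ++ Word.opp (Γ.path a (b.face 1))))
    have hopp : ∀ w : Word, (Word.opp w).map (Simplex.move P) =
        Word.opp (w.map (Simplex.move P)) := fun w => by
      simp only [Word.opp, List.map_reverse, List.map_map]
      congr 2
      funext c
      change Simplex.move P c.opp = (Simplex.move P c).opp
      ext j
      · fin_cases j <;> rfl
      · rfl
    rw [List.map_append, List.map_append, hopp, Γ.covariant, Γ.covariant] at e
    exact e

theorem gEm_covariant (𝔽 : QuantumEMField H) (Γ : PathFrameSystem) (P : Poincare) (a : Simplex 0)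
    (a' : Component 0 a) :
    𝔽.U P * 𝔽.gEm Γ a a' * star (𝔽.U P) = 𝔽.gEm Γ (a.move P) (a'.move P) := by
  rw [gEm_eq, gEm_eq, coneProd_covariant, Γ.covariant]

/-- Since p_{(a,a)} is degenerate, g_a(a) = 1 and the conjugation is the identity, whatever the
family u is. -/
theorem gEm_isGaugeTransformation (𝔽 : QuantumEMField H) (Γ : PathFrameSystem) (u : Family H) :
    IsGaugeTransformation u 𝔽.U (𝔽.gEm Γ) := by
  refine ⟨𝔽.gEm_covariant Γ, fun a o _ _ => ?_⟩
  rw [gEm_eq, coneProd_path_base]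
  simp

theorem gaugeTransform_gEm (𝔽 : QuantumEMField H) (Γ : PathFrameSystem) :
    gaugeTransform (𝔽.gEm Γ) (𝔽.uEm euclidean) = 𝔽.uEm Γ := by
  funext a b
  rw [gaugeTransform, gEm_eq, gEm_eq, uEm_euclidean, uEm_eq]

theorem gEm_isEquivalence (𝔽 : QuantumEMField H) (Γ : PathFrameSystem) :
    IsEquivalence (𝔽.uEm euclidean) 𝔽.U (𝔽.uEm Γ) 𝔽.U (𝔽.gEm Γ) := by
  refine ⟨fun a b => ?_, fun P a a' => ?_⟩
  · rw [← gaugeTransform_gEm 𝔽 Γ, gaugeTransform, mul_assoc, Unitary.star_mul_self, mul_one]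
  · rw [← gEm_covariant, mul_assoc, Unitary.star_mul_self, mul_one]

theorem uEm_euclidean_eq_uPot (𝔽 : QuantumEMField H) : 𝔽.uEm euclidean = 𝔽.uPot := by
  funext a b
  rw [uEm_euclidean, wEm_cone_eq_expI_lineIntegral, uPot]

end QuantumEMField

end
end EMLoops

theorem theorem4p8 {H : Type*} [NormedAddCommGroup H] [InnerProductSpace ℂ H] [CompleteSpace H]
    (𝔽 : QuantumEMField H) (Γ : PathFrameSystem) :
    IsCausalCovariantConnection (𝔽.uEm Γ) 𝔽.U ∧
    IsCausalCovariantConnection (𝔽.uEm euclidean) 𝔽.U ∧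
    IsCausalCovariantConnection 𝔽.uPot 𝔽.U ∧
    IsGaugeTransformation (𝔽.uEm euclidean) 𝔽.U (𝔽.gEm Γ) ∧
    gaugeTransform (𝔽.gEm Γ) (𝔽.uEm euclidean) = 𝔽.uEm Γ ∧
    IsEquivalence (𝔽.uEm euclidean) 𝔽.U (𝔽.uEm Γ) 𝔽.U (𝔽.gEm Γ) ∧
    𝔽.uEm euclidean = 𝔽.uPot :=
  ⟨𝔽.uEm_isCausalCovariantConnection Γ, 𝔽.uEm_isCausalCovariantConnection euclidean,
    𝔽.uEm_euclidean_eq_uPot ▸ 𝔽.uEm_isCausalCovariantConnection euclidean,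
    𝔽.gEm_isGaugeTransformation Γ _, 𝔽.gaugeTransform_gEm Γ, 𝔽.gEm_isEquivalence Γ,
    𝔽.uEm_euclidean_eq_uPot⟩
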